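/- Let $G=(V,E)$ be a finite simple graph. An edge $xy\in E$ is called relating if there is an independent set $S\subseteq V$, containing neither $x$ nor $y$, such that both $S\cup\{x\}$ and $S\cup\{y\}$ are (inclusion-)maximal independent sets of $G$. Theorem. The following problem can be solved in $O(|V|(|V|+|E|))$ time. Input: a finite simple graph $G=(V,E)$, given by adjacency lists, that has no subgraph (induced or not) isomorphic to the cycle $C_6$ or to the cycle $C_7$, and an edge $xy\in E$. Question: is $xy$ relating? Here time is the number of steps on a random access machine with words of $O(\log|V|)$ bits, indirect addressing, addition, truncated subtraction and comparisons: there are a single program $P$ and constants $k$ and $C$ such that on every such input, with the vertices numbered $0,\dots,|V|-1$ and the neighbours of each vertex listed in any order, $P$ halts after at most $C\,|V|(|V|+|E|)$ steps, produces no number $\ge |V|^k$ on the way, and returns $1$ if $xy$ is relating and $0$ if it is not. -/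

import Mathlib

/-! ## Relating edges -/

/-- The edge `xy` of `G` is relating: there is an independent set `S`, containing neither `x` nor
`y`, such that `S ∪ {x}` and `S ∪ {y}` are both (inclusion-)maximal independent sets of `G`. -/
def IsRelatingEdge {V : Type*} (G : SimpleGraph V) (x y : V) : Prop :=
  G.Adj x y ∧ ∃ S : Set V, G.IsIndepSet S ∧ x ∉ S ∧ y ∉ S ∧
    Maximal G.IsIndepSet (S ∪ {x}) ∧ Maximal G.IsIndepSet (S ∪ {y})

/-! ## A random access machine with logarithmic word size, and its running time

A program names finitely many registers and finitely many arrays. Every register and every array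
cell holds a natural number. The machine has indirect addressing, addition, truncated subtraction
and comparisons, but no multiplication and no bit operations; the control flow of a program is
structured. Each instruction and each evaluation of a test costs one step. -/

namespace RAM

/-- `reg i` is the content of register `i`, and `mem a i` is the cell of address `i` of array `a`. -/
@[ext]
structure State where
  reg : ℕ → ℕ
  mem : ℕ → ℕ → ℕ

namespace State

/-- Write `v` into register `i`. -/
def setReg (s : State) (i v : ℕ) : State :=
  { s with reg := Function.update s.reg i v }

/-- Write `v` into the cell of address `i` of array `a`. -/
def setMem (s : State) (a i v : ℕ) : State :=
  { s with mem := Function.update s.mem a (Function.update (s.mem a) i v) }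

end State

/-- Comparisons of two registers. -/
inductive Test where
  | lt (i j : ℕ)
  | le (i j : ℕ)
  | eq (i j : ℕ)
  | ne (i j : ℕ)

/-- The truth value of a test in a state. -/
def Test.Holds (s : State) : Test → Prop
  | .lt i j => s.reg i < s.reg j
  | .le i j => s.reg i ≤ s.reg j
  | .eq i j => s.reg i = s.reg j
  | .ne i j => s.reg i ≠ s.reg j

/-- Programs. -/
inductive Program where
  /-- do nothing -/
  | skip
  /-- `reg i := c` -/
  | const (i c : ℕ)
  /-- `reg i := reg j` -/
  | copy (i j : ℕ)
  /-- `reg i := reg j + reg k` -/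
  | add (i j k : ℕ)
  /-- `reg i := reg j - reg k`, truncated at `0` -/
  | sub (i j k : ℕ)
  /-- `reg i := mem a (reg j)` -/
  | load (i a j : ℕ)
  /-- `mem a (reg i) := reg j` -/
  | store (a i j : ℕ)
  | seq (p q : Program)
  | ite (b : Test) (p q : Program)
  | while (b : Test) (p : Program)

/-- `Exec W p s t s'`: on a machine whose words hold the numbers `0, …, W - 1`, the program `p`,
started in the state `s`, halts after exactly `t` steps in the state `s'`, and no overflow occurs on
the way. Only `const` and `add` can produce a number larger than those already stored, so the
overflow condition stands there; an execution that would overflow is stuck. -/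
inductive Exec (W : ℕ) : Program → State → ℕ → State → Prop where
  | skip (s : State) : Exec W .skip s 1 s
  | const (s : State) (i c : ℕ) (h : c < W) : Exec W (.const i c) s 1 (s.setReg i c)
  | copy (s : State) (i j : ℕ) : Exec W (.copy i j) s 1 (s.setReg i (s.reg j))
  | add (s : State) (i j k : ℕ) (h : s.reg j + s.reg k < W) :
      Exec W (.add i j k) s 1 (s.setReg i (s.reg j + s.reg k))
  | sub (s : State) (i j k : ℕ) : Exec W (.sub i j k) s 1 (s.setReg i (s.reg j - s.reg k))
  | load (s : State) (i a j : ℕ) : Exec W (.load i a j) s 1 (s.setReg i (s.mem a (s.reg j)))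
  | store (s : State) (a i j : ℕ) : Exec W (.store a i j) s 1 (s.setMem a (s.reg i) (s.reg j))
  | seq {p q : Program} {s s' s'' : State} {t t' : ℕ} (hp : Exec W p s t s')
      (hq : Exec W q s' t' s'') : Exec W (.seq p q) s (t + t') s''
  | ite_true {b : Test} {p q : Program} {s s' : State} {t : ℕ} (hb : b.Holds s)
      (hp : Exec W p s t s') : Exec W (.ite b p q) s (t + 1) s'
  | ite_false {b : Test} {p q : Program} {s s' : State} {t : ℕ} (hb : ¬ b.Holds s)
      (hq : Exec W q s t s') : Exec W (.ite b p q) s (t + 1) s'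
  | while_true {b : Test} {p : Program} {s s' s'' : State} {t t' : ℕ} (hb : b.Holds s)
      (hp : Exec W p s t s') (hw : Exec W (.while b p) s' t' s'') :
      Exec W (.while b p) s (t + t' + 1) s''
  | while_false {b : Test} {p : Program} {s : State} (hb : ¬ b.Holds s) :
      Exec W (.while b p) s 1 s

end RAM

/-! ## Graphs as inputs -/

/-- `adj` is an adjacency list representation of the graph `G` on the vertices `0, …, n - 1`: the
list `adj u` contains each neighbour of `u` exactly once, in any order. -/
structure IsAdjacencyLists {n : ℕ} (G : SimpleGraph (Fin n)) (adj : Fin n → List (Fin n)) :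
    Prop where
  nodup : ∀ u, (adj u).Nodup
  mem_iff : ∀ u v, v ∈ adj u ↔ G.Adj u v

/-- The total length of the adjacency lists of the vertices `u < i`: the position at which the list
of vertex `i` starts in the concatenation of all lists. -/
def adjOffset {n : ℕ} (adj : Fin n → List (Fin n)) (i : ℕ) : ℕ :=
  ∑ u : Fin n, if u.val < i then (adj u).length else 0

/-- The concatenation of the adjacency lists of the vertices `0, …, n - 1`, in this order. -/
def adjConcat {n : ℕ} (adj : Fin n → List (Fin n)) : List ℕ :=
  (List.finRange n).flatMap fun u => (adj u).map Fin.val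

/-- The initial state for a graph given by its adjacency lists, with two of its vertices. Registers
`0`, `1`, `2` hold `n`, `x`, `y`. Array `0` holds, at the addresses `0, …, n`, the starting
positions of the lists of the vertices `0, …, n - 1` and the total length. Array `1` holds the
concatenated lists. Everything else is `0`. -/
def edgeInput {n : ℕ} (adj : Fin n → List (Fin n)) (x y : Fin n) : RAM.State where
  reg := fun i => if i = 0 then n else if i = 1 then x.val else if i = 2 then y.val else 0
  mem := fun a i =>
    if a = 0 then (if i ≤ n then adjOffset adj i else 0)
    else if a = 1 then (adjConcat adj).getD i 0
    else 0

/-! ## Private neighbours and their candidates for dominating vertices -/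

namespace SimpleGraph

variable {V : Type*}

/-! Call a vertex private if it lies in exactly one of the closed neighbourhoods of `x` and `y`, and
call a vertex outside both a candidate if it sees a private vertex. The edge is relating exactly
when some independent set of candidates dominates all private vertices (`isRelatingEdge_iff`).

Forbidding $C_6$ makes adjacent candidates see private vertices of the same endpoint
(`root_eq_root`). That endpoint then closes a path of three candidates to a hexagon, and one of four
candidates to a heptagon, unless the two ends of the path see one and the same private vertex
(`eq_of_path_three`, `eq_of_path_four`). So a single neighbouring candidate per candidate, its
partner, carries enough information. A private vertex that is not `Needy` is dominated by every
maximal independent set of candidates. For the needy ones only the pairs of mutual partners matter: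
the edge is relating iff one can pick at most one candidate from each mutual pair so that every
needy vertex is hit (`isRelatingEdge_iff_exists_mutual`).

This is a satisfiability problem: pairs are variables, candidates are literals, needy vertices are
clauses. The same short cycles restrict how clauses overlap (`ChoiceSystem`). A clause with one
literal forces it; a clause with two literals, exactly one of which occurs in a further clause,
forces that one (`choosable_after_iff_of_big`). Once nothing is forced and no clause is empty,
Hall's theorem gives a solution (`choosable_of_two_le`).

The needy test takes $O(|V|(|V|+|E|))$ steps and the other preparations are linear. A round of
forcing is linear and removes a clause unless it is the last round, so there are at most $|V|+1$
rounds. -/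

theorem not_hexagon {G : SimpleGraph V} (h : (cycleGraph 6).Free G) {a b c d e f : V}
    (hn : [a, b, c, d, e, f].Nodup) (hab : G.Adj a b) (hbc : G.Adj b c) (hcd : G.Adj c d)
    (hde : G.Adj d e) (hef : G.Adj e f) (hfa : G.Adj f a) : False := by
  refine h ⟨⟨⟨fun i : Fin 6 => [a, b, c, d, e, f].get i, ?_⟩, List.nodup_iff_injective_get.1 hn⟩⟩
  intro i j hij
  rw [cycleGraph_adj] at hij
  fin_cases i <;> fin_cases j <;>
    first
    | exact absurd hij (by decide)
    | assumption
    | (apply Adj.symm; assumption)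

theorem not_heptagon {G : SimpleGraph V} (h : (cycleGraph 7).Free G) {a b c d e f g : V}
    (hn : [a, b, c, d, e, f, g].Nodup) (hab : G.Adj a b) (hbc : G.Adj b c) (hcd : G.Adj c d)
    (hde : G.Adj d e) (hef : G.Adj e f) (hfg : G.Adj f g) (hga : G.Adj g a) : False := by
  refine h ⟨⟨⟨fun i : Fin 7 => [a, b, c, d, e, f, g].get i, ?_⟩, List.nodup_iff_injective_get.1 hn⟩⟩
  intro i j hij
  rw [cycleGraph_adj] at hij
  fin_cases i <;> fin_cases j <;>
    first
    | exact absurd hij (by decide)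
    | assumption
    | (apply Adj.symm; assumption)

/-- `v` lies in the closed neighbourhood of `z`. -/
def Near (G : SimpleGraph V) (z v : V) : Prop := v = z ∨ G.Adj v z

/-- `v` lies in exactly one of the closed neighbourhoods of `x` and `y`. -/
def Priv (G : SimpleGraph V) (x y v : V) : Prop := ¬(G.Near x v ↔ G.Near y v)

/-- `v` lies outside the closed neighbourhoods of `x` and `y` and dominates a private neighbour. -/
def Cand (G : SimpleGraph V) (x y v : V) : Prop :=
  ¬G.Near x v ∧ ¬G.Near y v ∧ ∃ a, G.Adj v a ∧ G.Priv x y a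

/-- The candidate `d` dominates the private neighbour `a`. -/
def Hits (G : SimpleGraph V) (x y a d : V) : Prop := G.Priv x y a ∧ G.Adj a d

open Classical in
/-- The one of `x`, `y` to which a private neighbour is adjacent. -/
noncomputable def root (G : SimpleGraph V) (x y a : V) : V := if G.Adj a x then x else y

variable {G : SimpleGraph V} {x y : V}

theorem Priv.adj_root (hxy : G.Adj x y) {a : V} (ha : G.Priv x y a) :
    G.Adj a (G.root x y a) := by
  have := hxy.symm
  unfold root
  split_ifs with h
  · exact h
  · unfold Priv Near at ha
    grind

theorem root_eq_or (a : V) : G.root x y a = x ∨ G.root x y a = y := by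
  unfold root
  split_ifs <;> simp

theorem Priv.ne_left (hxy : G.Adj x y) {a : V} (ha : G.Priv x y a) : a ≠ x := by
  rintro rfl
  exact ha ⟨fun _ => Or.inr hxy, fun _ => Or.inl rfl⟩

theorem Priv.ne_right (hxy : G.Adj x y) {a : V} (ha : G.Priv x y a) : a ≠ y := by
  rintro rfl
  exact ha ⟨fun _ => Or.inl rfl, fun _ => Or.inr hxy.symm⟩

theorem Priv.ne_root (hxy : G.Adj x y) {a : V} (ha : G.Priv x y a) (b : V) :
    a ≠ G.root x y b := by
  rcases root_eq_or (G := G) (x := x) (y := y) b with h | h <;> rw [h]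
  exacts [ha.ne_left hxy, ha.ne_right hxy]

theorem Cand.ne_root {d : V} (hd : G.Cand x y d) (b : V) : d ≠ G.root x y b := by
  rcases root_eq_or (G := G) (x := x) (y := y) b with h | h <;> rw [h] <;> rintro rfl
  exacts [hd.1 (Or.inl rfl), hd.2.1 (Or.inl rfl)]

theorem Priv.ne_cand {a d : V} (ha : G.Priv x y a) (hd : G.Cand x y d) : a ≠ d := by
  rintro rfl
  exact ha ⟨fun h => absurd h hd.1, fun h => absurd h hd.2.1⟩

theorem Cand.exists_hits {d : V} (hd : G.Cand x y d) : ∃ a, G.Hits x y a d := by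
  obtain ⟨a, h, ha⟩ := hd.2.2
  exact ⟨a, ha, h.symm⟩

/-- Adjacent candidates dominate private neighbours of the same end of the edge. -/
theorem root_eq_root (h6 : (cycleGraph 6).Free G) (hxy : G.Adj x y) {a b d e : V}
    (hd : G.Cand x y d) (he : G.Cand x y e) (hde : G.Adj d e) (ha : G.Hits x y a d)
    (hb : G.Hits x y b e) : G.root x y a = G.root x y b := by
  by_contra hne
  have hr : G.Adj (G.root x y a) (G.root x y b) := by
    rcases root_eq_or (G := G) (x := x) (y := y) a with h | h <;>
    rcases root_eq_or (G := G) (x := x) (y := y) b with h' | h' <;> rw [h, h']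
    exacts [absurd (h.trans h'.symm) hne, hxy, hxy.symm, absurd (h.trans h'.symm) hne]
  have hab : a ≠ b := by rintro rfl; exact hne rfl
  have h1 := ha.1.ne_root hxy
  have h2 := hb.1.ne_root hxy
  have h3 := hd.ne_root
  have h4 := he.ne_root
  have h5 := ha.1.ne_cand hd
  have h6' := ha.1.ne_cand he
  have h7 := hb.1.ne_cand hd
  have h8 := hb.1.ne_cand he
  refine not_hexagon h6 (a := G.root x y a) (b := a) (c := d) (d := e) (e := b)
    (f := G.root x y b) ?_ (ha.1.adj_root hxy).symm ha.2 hde hb.2.symm (hb.1.adj_root hxy) hr.symm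
  simp only [List.nodup_cons, List.mem_cons, List.not_mem_nil, or_false, not_or]
  exact ⟨⟨(h1 a).symm, (h3 a).symm, (h4 a).symm, (h2 a).symm, hne⟩, ⟨h5, h6', hab, h1 b⟩,
    ⟨hde.ne, h7.symm, h3 b⟩, ⟨h8.symm, h4 b⟩, h2 b, not_false, List.nodup_nil⟩

/-- Both private vertices are compared with one seen by the adjacent candidate `e`. -/
theorem root_eq_root_self (h6 : (cycleGraph 6).Free G) (hxy : G.Adj x y) {a b d e : V}
    (hd : G.Cand x y d) (he : G.Cand x y e) (hde : G.Adj d e) (ha : G.Hits x y a d)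
    (hb : G.Hits x y b d) : G.root x y a = G.root x y b := by
  obtain ⟨c, hc⟩ := he.exists_hits
  exact (root_eq_root h6 hxy hd he hde ha hc).trans (root_eq_root h6 hxy hd he hde hb hc).symm

/-- The common endpoint of the edge, `a`, `d`, `e`, `f`, `b` would form a hexagon. As `a` and `b`
are arbitrary, each end of the path sees only one private vertex. -/
theorem eq_of_path_three (h6 : (cycleGraph 6).Free G) (hxy : G.Adj x y) {a b d e f : V}
    (hd : G.Cand x y d) (he : G.Cand x y e) (hf : G.Cand x y f) (hde : G.Adj d e) (hef : G.Adj e f)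
    (hdf : d ≠ f) (ha : G.Hits x y a d) (hb : G.Hits x y b f) : a = b := by
  by_contra hab
  obtain ⟨c, hc⟩ := he.exists_hits
  have hr : G.root x y a = G.root x y b :=
    (root_eq_root h6 hxy hd he hde ha hc).trans (root_eq_root h6 hxy he hf hef hc hb)
  have h1 := ha.1.ne_root hxy
  have h2 := hb.1.ne_root hxy
  refine not_hexagon h6 (a := G.root x y a) (b := a) (c := d) (d := e) (e := f)
    (f := b) ?_ (ha.1.adj_root hxy).symm ha.2 hde hef hb.2.symm (hr ▸ hb.1.adj_root hxy)
  simp only [List.nodup_cons, List.mem_cons, List.not_mem_nil, or_false, not_or]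
  exact ⟨⟨(h1 a).symm, (hd.ne_root a).symm, (he.ne_root a).symm, (hf.ne_root a).symm, (h2 a).symm⟩,
    ⟨ha.1.ne_cand hd, ha.1.ne_cand he, ha.1.ne_cand hf, hab⟩,
    ⟨hde.ne, hdf, (hb.1.ne_cand hd).symm⟩, ⟨hef.ne, (hb.1.ne_cand he).symm⟩,
    (hb.1.ne_cand hf).symm, not_false, List.nodup_nil⟩

/-- One more candidate on the path turns the hexagon into a heptagon. -/
theorem eq_of_path_four (h6 : (cycleGraph 6).Free G) (h7 : (cycleGraph 7).Free G) (hxy : G.Adj x y)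
    {a b d e f g : V} (hd : G.Cand x y d) (he : G.Cand x y e) (hf : G.Cand x y f)
    (hg : G.Cand x y g) (hde : G.Adj d e) (hef : G.Adj e f) (hfg : G.Adj f g) (hdf : d ≠ f)
    (heg : e ≠ g) (hdg : d ≠ g) (ha : G.Hits x y a d) (hb : G.Hits x y b g) : a = b := by
  by_contra hab
  obtain ⟨c, hc⟩ := he.exists_hits
  obtain ⟨c', hc'⟩ := hf.exists_hits
  have hr : G.root x y a = G.root x y b :=
    ((root_eq_root h6 hxy hd he hde ha hc).trans (root_eq_root h6 hxy he hf hef hc hc')).trans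
      (root_eq_root h6 hxy hf hg hfg hc' hb)
  have h1 := ha.1.ne_root hxy
  have h2 := hb.1.ne_root hxy
  refine not_heptagon h7 (a := G.root x y a) (b := a) (c := d) (d := e) (e := f) (f := g)
    (g := b) ?_ (ha.1.adj_root hxy).symm ha.2 hde hef hfg hb.2.symm (hr ▸ hb.1.adj_root hxy)
  simp only [List.nodup_cons, List.mem_cons, List.not_mem_nil, or_false, not_or]
  exact ⟨⟨(h1 a).symm, (hd.ne_root a).symm, (he.ne_root a).symm, (hf.ne_root a).symm,
      (hg.ne_root a).symm, (h2 a).symm⟩,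
    ⟨ha.1.ne_cand hd, ha.1.ne_cand he, ha.1.ne_cand hf, ha.1.ne_cand hg, hab⟩,
    ⟨hde.ne, hdf, hdg, (hb.1.ne_cand hd).symm⟩, ⟨hef.ne, heg, (hb.1.ne_cand he).symm⟩,
    ⟨hfg.ne, (hb.1.ne_cand hf).symm⟩, (hb.1.ne_cand hg).symm, not_false, List.nodup_nil⟩

/-- The hexagon runs through an endpoint of the edge, `b`, `d`, `a`, `e`, `c`. The candidates `d'`
and `e'` serve only to show that `b` and `c` belong to the same endpoint. -/
theorem eq_of_common_hit (h6 : (cycleGraph 6).Free G) (hxy : G.Adj x y) {a b c d e d' e' : V}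
    (hd : G.Cand x y d) (hd' : G.Cand x y d') (hdd : G.Adj d d')
    (he : G.Cand x y e) (he' : G.Cand x y e') (hee : G.Adj e e') (hde : d ≠ e)
    (hb : G.Hits x y b d) (ha : G.Hits x y a d) (ha' : G.Hits x y a e) (hc : G.Hits x y c e)
    (hba : b ≠ a) (hca : c ≠ a) : b = c := by
  by_contra hbc
  have hr : G.root x y b = G.root x y c :=
    (root_eq_root_self h6 hxy hd hd' hdd hb ha).trans (root_eq_root_self h6 hxy he he' hee ha' hc)
  refine not_hexagon h6 (a := G.root x y b) (b := b) (c := d) (d := a) (e := e) (f := c) ?_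
    (hb.1.adj_root hxy).symm hb.2 ha.2.symm ha'.2 hc.2.symm (hr ▸ hc.1.adj_root hxy)
  simp only [List.nodup_cons, List.mem_cons, List.not_mem_nil, or_false, not_or]
  exact ⟨⟨(hb.1.ne_root hxy b).symm, (hd.ne_root b).symm, (ha.1.ne_root hxy b).symm,
      (he.ne_root b).symm, (hc.1.ne_root hxy b).symm⟩,
    ⟨hb.1.ne_cand hd, hba, hb.1.ne_cand he, hbc⟩,
    ⟨(ha.1.ne_cand hd).symm, hde, (hc.1.ne_cand hd).symm⟩, ⟨ha.1.ne_cand he, hca.symm⟩,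
    (hc.1.ne_cand he).symm, not_false, List.nodup_nil⟩

/-- Here the heptagon runs through an endpoint, `b`, `d'`, `d`, `a`, `e`, `c`. -/
theorem eq_or_eq_of_partner_hit (h6 : (cycleGraph 6).Free G) (h7 : (cycleGraph 7).Free G)
    (hxy : G.Adj x y) {a b c d e d' e' : V}
    (hd : G.Cand x y d) (hd' : G.Cand x y d') (hdd : G.Adj d d')
    (he : G.Cand x y e) (he' : G.Cand x y e') (hee : G.Adj e e') (hde : d ≠ e) (hde' : d' ≠ e)
    (ha : G.Hits x y a d) (hb : G.Hits x y b d') (ha' : G.Hits x y a e) (hc : G.Hits x y c e)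
    (hca : c ≠ a) : b = a ∨ b = c := by
  by_contra! hbc
  obtain ⟨hba, hbc⟩ := hbc
  have hr : G.root x y b = G.root x y c :=
    (root_eq_root h6 hxy hd' hd hdd.symm hb ha).trans
      (root_eq_root_self h6 hxy he he' hee ha' hc)
  refine not_heptagon h7 (a := G.root x y b) (b := b) (c := d') (d := d) (e := a) (f := e)
    (g := c) ?_ (hb.1.adj_root hxy).symm hb.2 hdd.symm ha.2.symm ha'.2 hc.2.symm
    (hr ▸ hc.1.adj_root hxy)
  simp only [List.nodup_cons, List.mem_cons, List.not_mem_nil, or_false, not_or]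
  exact ⟨⟨(hb.1.ne_root hxy b).symm, (hd'.ne_root b).symm, (hd.ne_root b).symm,
      (ha.1.ne_root hxy b).symm, (he.ne_root b).symm, (hc.1.ne_root hxy b).symm⟩,
    ⟨hb.1.ne_cand hd', hb.1.ne_cand hd, hba, hb.1.ne_cand he, hbc⟩,
    ⟨hdd.ne.symm, (ha.1.ne_cand hd').symm, hde', (hc.1.ne_cand hd').symm⟩,
    ⟨(ha.1.ne_cand hd).symm, hde, (hc.1.ne_cand hd).symm⟩, ⟨ha.1.ne_cand he, hca.symm⟩,
    (hc.1.ne_cand he).symm, not_false, List.nodup_nil⟩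

/-! ## Relating edges and dominating sets of candidates -/

theorem exists_indepSet_superset [Finite V] (P : V → Prop) {T : Set V} (hT : G.IsIndepSet T)
    (hP : ∀ v ∈ T, P v) :
    ∃ S, T ⊆ S ∧ G.IsIndepSet S ∧ (∀ v ∈ S, P v) ∧ ∀ v, P v → v ∉ S → ∃ s ∈ S, G.Adj v s := by
  obtain ⟨S, hTS, hS⟩ := Finite.exists_le_maximal
    (p := fun S : Set V => G.IsIndepSet S ∧ ∀ v ∈ S, P v) ⟨hT, hP⟩
  refine ⟨S, hTS, hS.prop.1, hS.prop.2, fun v hv hvS => ?_⟩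
  by_contra! hno
  refine hvS (hS.le_of_ge (y := insert v S) ⟨?_, ?_⟩ (Set.subset_insert v S)
    (Set.mem_insert v S))
  · refine hS.prop.1.insert fun b hb _ => ?_
    exact ⟨hno b hb, fun h => hno b hb h.symm⟩
  · rintro w (rfl | hw)
    exacts [hv, hS.prop.2 w hw]

/-- A private vertex near `x` is not near `y`, so maximality of `S ∪ {y}` makes `S` itself dominate
it. Conversely, enlarge the dominating set to a maximal independent set among the vertices outside
both closed neighbourhoods; whatever it leaves undominated is near both endpoints. -/
theorem isRelatingEdge_iff [Finite V] (hxy : G.Adj x y) :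
    IsRelatingEdge G x y ↔ ∃ S : Set V, G.IsIndepSet S ∧ (∀ v ∈ S, G.Cand x y v) ∧
      ∀ a, G.Priv x y a → ∃ s ∈ S, G.Adj a s := by
  constructor
  · rintro ⟨-, S, -, hxS, hyS, hx, hy⟩
    have hnx : ∀ s ∈ S, ¬G.Near x s := by
      rintro s hs (rfl | h)
      · exact hxS hs
      · exact hx.prop (Or.inl hs) (Or.inr rfl) h.ne h
    have hny : ∀ s ∈ S, ¬G.Near y s := by
      rintro s hs (rfl | h)
      · exact hyS hs
      · exact hy.prop (Or.inl hs) (Or.inr rfl) h.ne h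
    have key : ∀ z, Maximal G.IsIndepSet (S ∪ {z}) → ∀ a, ¬G.Near z a → a ∉ S →
        ∃ s ∈ S, G.Adj a s := by
      intro z hz a ha haS
      by_contra! hno
      have : a ∈ S ∪ {z} := by
        refine hz.le_of_ge (y := insert a (S ∪ {z})) ?_ (Set.subset_insert _ _)
          (Set.mem_insert _ _)
        refine hz.prop.insert fun b hb _ => ?_
        have : ¬G.Adj a b := by
          rcases hb with hb | rfl
          exacts [hno b hb, fun h => ha (Or.inr h)]
        exact ⟨this, fun h => this h.symm⟩
      rcases this with h | h
      exacts [haS h, ha (Or.inl h)]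
    have hdom : ∀ a, G.Priv x y a → ∃ s ∈ S, G.Adj a s := by
      intro a ha
      by_cases hax : G.Near x a
      · have hay : ¬G.Near y a := fun h => ha ⟨fun _ => h, fun _ => hax⟩
        exact key y hy a hay fun h => hnx a h hax
      · have hay : G.Near y a := by
          by_contra h
          exact ha ⟨fun h' => absurd h' hax, fun h' => absurd h' h⟩
        exact key x hx a hax fun h => hny a h hay
    -- Members of `S` that see no private vertex contribute nothing to the domination and are
    -- dropped.
    refine ⟨{s ∈ S | G.Cand x y s}, ?_, fun v hv => hv.2, fun a ha => ?_⟩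
    · exact (hx.prop.mono Set.subset_union_left).mono (Set.sep_subset _ _)
    · obtain ⟨s, hs, h⟩ := hdom a ha
      exact ⟨s, ⟨hs, hnx s hs, hny s hs, a, h.symm, ha⟩, h⟩
  · rintro ⟨T, hT, hTc, hTd⟩
    obtain ⟨S, hTS, hS, hSP, hmax⟩ := exists_indepSet_superset
      (fun v => ¬G.Near x v ∧ ¬G.Near y v) hT fun v hv => ⟨(hTc v hv).1, (hTc v hv).2.1⟩
    refine ⟨hxy, S, hS, fun h => (hSP x h).1 (Or.inl rfl), fun h => (hSP y h).2 (Or.inl rfl), ?_, ?_⟩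
    all_goals
      refine ⟨?_, ?_⟩
      · rw [Set.union_singleton]
        refine hS.insert fun b hb _ => ?_
        have h := hSP b hb
        exact ⟨fun h' => by first | exact h.1 (Or.inr h'.symm) | exact h.2 (Or.inr h'.symm),
          fun h' => by first | exact h.1 (Or.inr h') | exact h.2 (Or.inr h')⟩
      · intro U hU hle v hv
        by_contra hvS
        have hadj : ∀ w ∈ S, ¬G.Adj v w := fun w hw h => hU hv (hle (Or.inl hw)) h.ne h
        have hvS' : v ∉ S := fun h => hvS (Or.inl h)
        have h2 : G.Near x v ∨ G.Near y v := by
          by_contra! h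
          obtain ⟨s, hs, h'⟩ := hmax v h hvS'
          exact hadj s hs h'
        have h1 : ¬G.Priv x y v := fun h => by
          obtain ⟨s, hs, h'⟩ := hTd v h
          exact hadj s (hTS hs) h'
        have h1 : G.Near x v ↔ G.Near y v := not_not.1 h1
        -- The vertex is neither private nor far from both endpoints, so whichever endpoint was
        -- added to `S` excludes it.
        have h3 : G.Near x v ∧ G.Near y v := by tauto
        first
        | (rcases h3.1 with rfl | h
           · exact hvS (Or.inr rfl)
           · exact hU hv (hle (Or.inr rfl)) h.ne h)
        | (rcases h3.2 with rfl | h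
           · exact hvS (Or.inr rfl)
           · exact hU hv (hle (Or.inr rfl)) h.ne h)

end SimpleGraph

/-! ## Reduction to a choice between partners -/

namespace SimpleGraph

variable {V : Type*}

/-- `pt` sends each vertex to one of its neighbours among the candidates, if there is one. -/
structure IsPartner (G : SimpleGraph V) (x y : V) (pt : V → Option V) : Prop where
  none : ∀ d, pt d = none → ∀ e, G.Adj d e → ¬G.Cand x y e
  some : ∀ d e, pt d = some e → G.Adj d e ∧ G.Cand x y e

/-- The private neighbours that are not dominated by every maximal independent set of candidates. -/
def Needy (G : SimpleGraph V) (x y : V) (pt : V → Option V) (a : V) : Prop :=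
  G.Priv x y a ∧ ∀ d, G.Cand x y d → G.Adj a d → ∃ e, pt d = some e ∧ ¬G.Adj a e

/-- The candidates whose partner relation is mutual. -/
def Mutual (G : SimpleGraph V) (x y : V) (pt : V → Option V) (d : V) : Prop :=
  G.Cand x y d ∧ ∃ e, pt d = some e ∧ pt e = some d

variable {G : SimpleGraph V} {x y : V} {pt : V → Option V}

/-- From `s ∈ S` dominating a needy `a`, follow the partners `s`, `c`, `l`, `e`. The path lemmas
make this walk turn back early: either `l = s` and `s` is mutual, or `e = c` and `l` is mutual. In
the latter case `l` ends a path of three candidates that starts at `s`, so it sees `a` as well and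
can replace `s`. -/
theorem exists_mutual_of_indepSet (h6 : (cycleGraph 6).Free G) (h7 : (cycleGraph 7).Free G)
    (hxy : G.Adj x y) (hpt : G.IsPartner x y pt) {S : Set V} (hS : G.IsIndepSet S)
    (hSc : ∀ v ∈ S, G.Cand x y v) (hSd : ∀ a, G.Priv x y a → ∃ s ∈ S, G.Adj a s) :
    ∃ T : Set V, (∀ d ∈ T, G.Mutual x y pt d) ∧ (∀ d ∈ T, ∀ e ∈ T, pt d ≠ some e) ∧
      ∀ a, G.Needy x y pt a → ∃ d ∈ T, G.Adj a d := by
  have hadj : ∀ d ∈ S, ∀ e ∈ S, ¬G.Adj d e := fun d hd e he h => hS hd he h.ne h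
  -- A replacement for `s` is the partner of its partner. Each chosen candidate is required to see a
  -- needy vertex because the last conflict case below relies on one.
  refine ⟨{d | G.Mutual x y pt d ∧ (∃ a, G.Needy x y pt a ∧ G.Adj a d) ∧
    (d ∈ S ∨ ∃ s ∈ S, ∃ c, pt s = some c ∧ pt c = some d ∧ pt d = some c)},
    fun d hd => hd.1, ?_, ?_⟩
  · rintro d ⟨⟨hdc, e', hde', hed⟩, ⟨a, ha, had⟩, hd⟩ e ⟨⟨hec, -⟩, -, he⟩ hde
    obtain rfl : e = e' := by simpa [hde] using hde'
    have hade := (hpt.some _ _ hde).1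
    rcases hd with hd | ⟨s, hs, c, hsc, hcd, hdc'⟩ <;> rcases he with he | ⟨u, hu, f, huf, hfe, hef⟩
    · exact hadj d hd e he hade
    · obtain rfl : d = f := by simpa [hed] using hef
      exact hadj u hu d hd (hpt.some _ _ huf).1
    · obtain rfl : e = c := by simpa [hde] using hdc'
      exact hadj s hs e he (hpt.some _ _ hsc).1
    -- Both candidates are replacements, so `s`, `e`, `d`, `u` is a path. Its path equalities let
    -- `a` see `e`, the partner of `d`, which neediness forbids.
    · obtain rfl : d = f := by simpa [hed] using hef
      obtain rfl : e = c := by simpa [hde] using hdc'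
      have hse := (hpt.some _ _ hsc).1
      have hud := (hpt.some _ _ huf).1
      have hsd : s ≠ d := by rintro rfl; exact hadj _ hu _ hs hud
      have hue : u ≠ e := by rintro rfl; exact hadj _ hs _ hu hse
      have hsu : s ≠ u := by
        rintro rfl
        rw [hsc] at huf
        exact hade.ne (Option.some.inj huf).symm
      obtain ⟨b, hb⟩ := (hSc s hs).exists_hits
      obtain ⟨b', hb'⟩ := (hSc u hu).exists_hits
      obtain ⟨c, hc⟩ := hec.exists_hits
      have e1 := eq_of_path_three h6 hxy (hSc s hs) hec hdc hse hade.symm hsd hb ⟨ha.1, had⟩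
      have e2 := eq_of_path_three h6 hxy hec hdc (hSc u hu) hade.symm hud.symm hue.symm hc hb'
      have e3 := eq_of_path_four h6 h7 hxy (hSc s hs) hec hdc (hSc u hu) hse hade.symm hud.symm hsd
        hue.symm hsu hb hb'
      obtain ⟨e', h1, h2⟩ := ha.2 d hdc had
      obtain rfl : e = e' := by simpa [hde] using h1
      have : c = a := e2.trans (e3.symm.trans e1)
      exact h2 (this ▸ hc.2)
  · intro a ha
    obtain ⟨s, hs, has⟩ := hSd a ha.1
    have hsC := hSc s hs
    obtain ⟨c, hsc, hac⟩ := ha.2 s hsC has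
    obtain ⟨hadj_sc, hcC⟩ := hpt.some _ _ hsc
    rcases hcl : pt c with _ | l
    · exact absurd hsC (hpt.none _ hcl _ hadj_sc.symm)
    by_cases hls : l = s
    · subst hls
      exact ⟨l, ⟨⟨hsC, c, hsc, hcl⟩, ⟨a, ha, has⟩, Or.inl hs⟩, has⟩
    obtain ⟨hadj_cl, hlC⟩ := hpt.some _ _ hcl
    obtain ⟨b, hb⟩ := hlC.exists_hits
    have hab := eq_of_path_three h6 hxy hsC hcC hlC hadj_sc hadj_cl (Ne.symm hls) ⟨ha.1, has⟩ hb
    obtain ⟨c0, hc0⟩ := hcC.exists_hits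
    have hc0a : c0 ≠ a := by rintro rfl; exact hac hc0.2
    subst hab
    rcases hle : pt l with _ | e
    · exact absurd hcC (hpt.none _ hle _ hadj_cl.symm)
    obtain ⟨hadj_le, heC⟩ := hpt.some _ _ hle
    by_cases hec : e = c
    · subst hec
      exact ⟨l, ⟨⟨hlC, e, hle, hcl⟩, ⟨a, ha, hb.2⟩, Or.inr ⟨s, hs, e, hsc, hcl, hle⟩⟩, hb.2⟩
    -- If the walk goes on past `l`, the path lemmas make `a` the private vertex that `c` sees,
    -- contrary to `hac`.
    obtain ⟨f, hf⟩ := heC.exists_hits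
    have e1 := eq_of_path_three h6 hxy hcC hlC heC hadj_cl hadj_le (Ne.symm hec) hc0 hf
    by_cases hes : e = s
    · subst hes
      exact absurd (eq_of_path_three h6 hxy hcC hlC heC hadj_cl hadj_le (Ne.symm hec) hc0
        ⟨ha.1, has⟩) hc0a
    · have e2 := eq_of_path_four h6 h7 hxy hsC hcC hlC heC hadj_sc hadj_cl hadj_le (Ne.symm hls)
        (Ne.symm hec) (Ne.symm hes) ⟨ha.1, has⟩ hf
      exact absurd (e1.trans e2.symm) hc0a

/-- The chosen candidates are extended to a maximal independent set of candidates. A private `a`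
that is not needy has a candidate neighbour `d` with no partner, or with a partner seeing `a`. The
set contains `d` or a candidate adjacent to `d`, and in the second case `eq_of_path_three` shows
that this candidate sees `a`. -/
theorem exists_indepSet_of_mutual [Finite V] (h6 : (cycleGraph 6).Free G)
    (h7 : (cycleGraph 7).Free G) (hxy : G.Adj x y) (hpt : G.IsPartner x y pt) {T : Set V}
    (hT : ∀ d ∈ T, G.Mutual x y pt d) (hT' : ∀ d ∈ T, ∀ e ∈ T, pt d ≠ some e)
    (hTd : ∀ a, G.Needy x y pt a → ∃ d ∈ T, G.Adj a d) :
    ∃ S : Set V, G.IsIndepSet S ∧ (∀ v ∈ S, G.Cand x y v) ∧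
      ∀ a, G.Priv x y a → ∃ s ∈ S, G.Adj a s := by
  -- The hypothesis on `T` excludes only partners, whereas independence excludes all edges. An edge
  -- between members of different pairs would let the needy `a` see the partner of `d`.
  have hind : G.IsIndepSet {d ∈ T | ∃ a, G.Needy x y pt a ∧ G.Adj a d} := by
    rintro d ⟨hd, a, ha, had⟩ e ⟨he, -⟩ - hade
    obtain ⟨hdC, f, hdf, -⟩ := hT d hd
    obtain ⟨heC, g, heg, -⟩ := hT e he
    obtain ⟨hadj_df, hfC⟩ := hpt.some _ _ hdf
    obtain ⟨hadj_eg, hgC⟩ := hpt.some _ _ heg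
    have hef : e ≠ f := by rintro rfl; exact hT' d hd e he hdf
    have hdg : d ≠ g := by rintro rfl; exact hT' e he d hd heg
    obtain ⟨f', h1, haf⟩ := ha.2 d hdC had
    obtain rfl : f = f' := by simpa [hdf] using h1
    obtain ⟨b, hb⟩ := hfC.exists_hits
    obtain ⟨c, hc⟩ := hgC.exists_hits
    have e1 := eq_of_path_three h6 hxy hdC heC hgC hade hadj_eg hdg ⟨ha.1, had⟩ hc
    -- If the two partners coincide there is a triangle and no path of four; then everything seen by
    -- `f` is compared with what `e` sees, along the path `e`, `d`, `f`.
    have e2 : b = c := by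
      by_cases hfg : f = g
      · subst hfg
        obtain ⟨c', hc'⟩ := heC.exists_hits
        exact (eq_of_path_three h6 hxy heC hdC hfC hade.symm hadj_df hef hc' hb).symm.trans
          (eq_of_path_three h6 hxy heC hdC hfC hade.symm hadj_df hef hc' hc)
      · exact eq_of_path_four h6 h7 hxy hfC hdC heC hgC hadj_df.symm hade hadj_eg hef.symm hdg hfg
          hb hc
    rw [e1, ← e2] at haf
    exact haf hb.2
  obtain ⟨S, hTS, hS, hSc, hmax⟩ := exists_indepSet_superset (G.Cand x y) hind
    fun v hv => (hT v hv.1).1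
  refine ⟨S, hS, hSc, fun a ha => ?_⟩
  by_cases hN : G.Needy x y pt a
  · obtain ⟨d, hd, had⟩ := hTd a hN
    exact ⟨d, hTS ⟨hd, a, hN, had⟩, had⟩
  · unfold Needy at hN
    push Not at hN
    obtain ⟨d, hdC, had, hd⟩ := hN ha
    by_cases hdS : d ∈ S
    · exact ⟨d, hdS, had⟩
    obtain ⟨s, hs, hds⟩ := hmax d hdC hdS
    refine ⟨s, hs, ?_⟩
    rcases hde : pt d with _ | e
    · exact absurd (hSc s hs) (hpt.none _ hde _ hds)
    obtain ⟨hadj_de, heC⟩ := hpt.some _ _ hde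
    by_cases hse : s = e
    · subst hse
      exact hd s hde
    obtain ⟨b, hb⟩ := (hSc s hs).exists_hits
    have := eq_of_path_three h6 hxy (hSc s hs) hdC heC hds.symm hadj_de hse hb ⟨ha, hd e hde⟩
    exact this ▸ hb.2

theorem isRelatingEdge_iff_exists_mutual [Finite V] (h6 : (cycleGraph 6).Free G)
    (h7 : (cycleGraph 7).Free G) (hxy : G.Adj x y) (hpt : G.IsPartner x y pt) :
    IsRelatingEdge G x y ↔
      ∃ T : Set V, (∀ d ∈ T, G.Mutual x y pt d) ∧ (∀ d ∈ T, ∀ e ∈ T, pt d ≠ some e) ∧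
        ∀ a, G.Needy x y pt a → ∃ d ∈ T, G.Adj a d := by
  rw [isRelatingEdge_iff hxy]
  constructor
  · rintro ⟨S, hS, hSc, hSd⟩
    exact exists_mutual_of_indepSet h6 h7 hxy hpt hS hSc hSd
  · rintro ⟨T, hT, hT', hTd⟩
    exact exists_indepSet_of_mutual h6 h7 hxy hpt hT hT' hTd

end SimpleGraph

/-! ## Choosing one literal of each pair -/

section Choice

variable {V : Type*} (N : V → V → Prop) (τ : V → V)

/-- It is possible to choose at most one literal from each pair `{d, τ d}` in `L` such that every
clause in `A` contains a chosen literal. -/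
def Choosable (A L : Finset V) : Prop :=
  ∃ T ⊆ L, (∀ d ∈ T, τ d ∉ T) ∧ ∀ a ∈ A, ∃ d ∈ T, N a d

/-- The incidence properties of clauses and literals that a graph without cycles of length `6` and
`7` guarantees. -/
structure ChoiceSystem (A L : Finset V) : Prop where
  mem : ∀ {d}, d ∈ L → τ d ∈ L
  invol : ∀ {d}, d ∈ L → τ (τ d) = d
  nonempty : ∀ {d}, d ∈ L → ∃ b, N b d
  disj : ∀ {a d}, a ∈ A → d ∈ L → N a d → ¬N a (τ d)
  common : ∀ {a b c d e}, d ∈ L → e ∈ L → d ≠ e → N b d → N a d → N a e → N c e → b ≠ a → c ≠ a →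
    b = c
  partner : ∀ {a b c d e}, d ∈ L → e ∈ L → d ≠ e → τ d ≠ e → N a d → N b (τ d) → N a e → N c e →
    c ≠ a → b = a ∨ b = c

variable [∀ a, DecidablePred (N a)]

/-- The available literals of a clause. -/
def lits (L : Finset V) (a : V) : Finset V := L.filter (N a)

/-- The available literals of a clause that occur in a further clause. -/
def bigLits (A L : Finset V) (a : V) : Finset V :=
  (lits N L a).filter fun d => 2 ≤ (A.filter (N · d)).card

/-- The clauses that remain when the literal `q` is chosen. -/
def clausesAfter (A : Finset V) (q : V) : Finset V := A.filter fun a => ¬N a q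

variable {N τ} {A L : Finset V}

theorem mem_lits {a d : V} : d ∈ lits N L a ↔ d ∈ L ∧ N a d := Finset.mem_filter

theorem mem_bigLits {a d : V} :
    d ∈ bigLits N A L a ↔ (d ∈ L ∧ N a d) ∧ 2 ≤ (A.filter (N · d)).card := by
  rw [bigLits, Finset.mem_filter, mem_lits]

theorem not_choosable {a : V} (ha : a ∈ A) (h0 : (lits N L a).card = 0) : ¬Choosable N τ A L := by
  rintro ⟨T, hTL, -, hTA⟩
  obtain ⟨d, hd, had⟩ := hTA a ha
  rw [Finset.card_eq_zero] at h0
  exact Finset.notMem_empty d (h0 ▸ mem_lits.2 ⟨hTL hd, had⟩)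

theorem exists_ne_of_mem_bigLits {a d : V} (hd : d ∈ bigLits N A L a) :
    ∃ b ∈ A, b ≠ a ∧ N b d := by
  obtain ⟨b, hb, hba⟩ := Finset.exists_mem_ne (mem_bigLits.1 hd).2 a
  exact ⟨b, (Finset.mem_filter.1 hb).1, hba, (Finset.mem_filter.1 hb).2⟩

theorem mem_bigLits_of_ne {a b d : V} (hd : d ∈ L) (ha : a ∈ A) (hb : b ∈ A) (hab : a ≠ b)
    (had : N a d) (hbd : N b d) : d ∈ bigLits N A L a :=
  mem_bigLits.2 ⟨⟨hd, had⟩, Finset.one_lt_card.2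
    ⟨a, Finset.mem_filter.2 ⟨ha, had⟩, b, Finset.mem_filter.2 ⟨hb, hbd⟩, hab⟩⟩

variable [DecidableEq V]

variable (τ) in
/-- The literals that remain when the literal `q` is chosen. -/
def litsAfter (L : Finset V) (q : V) : Finset V := (L.erase q).erase (τ q)

theorem mem_litsAfter {d q : V} : d ∈ litsAfter τ L q ↔ d ≠ τ q ∧ d ≠ q ∧ d ∈ L := by
  simp [litsAfter]

theorem ChoiceSystem.after (h : ChoiceSystem N τ A L) {q : V} (hq : q ∈ L) :
    ChoiceSystem N τ (clausesAfter N A q) (litsAfter τ L q) := by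
  have hL : ∀ {d}, d ∈ litsAfter τ L q → d ∈ L := fun hd => (mem_litsAfter.1 hd).2.2
  refine ⟨fun {d} hd => ?_, fun hd => h.invol (hL hd), fun hd => h.nonempty (hL hd),
    fun ha hd => h.disj (Finset.mem_of_mem_filter _ ha) (hL hd),
    fun hd he => h.common (hL hd) (hL he), fun hd he => h.partner (hL hd) (hL he)⟩
  obtain ⟨h1, h2, h3⟩ := mem_litsAfter.1 hd
  refine mem_litsAfter.2 ⟨fun e => h2 ?_, fun e => h1 ?_, h.mem h3⟩
  · rw [← h.invol h3, e, h.invol hq]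
  · rw [← h.invol h3, e]

/-- A literal contained in every solution can be removed together with its mate and its clauses.
That `q` occurs in a clause is what rules out `τ q = q`. -/
theorem choosable_after_iff (h : ChoiceSystem N τ A L) {q : V} (hq : q ∈ L) (hqA : ∃ a ∈ A, N a q)
    (hforced : ∀ T ⊆ L, (∀ d ∈ T, τ d ∉ T) → (∀ a ∈ A, ∃ d ∈ T, N a d) → q ∈ T) :
    Choosable N τ (clausesAfter N A q) (litsAfter τ L q) ↔ Choosable N τ A L := by
  constructor
  · rintro ⟨T, hTL, hT, hTA⟩
    refine ⟨insert q T, ?_, ?_, ?_⟩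
    · exact Finset.insert_subset hq fun d hd => (mem_litsAfter.1 (hTL hd)).2.2
    · intro d hd hd'
      rw [Finset.mem_insert] at hd hd'
      have hne : τ q ≠ q := by
        obtain ⟨a, ha, haq⟩ := hqA
        intro e
        exact h.disj ha hq haq (e.symm ▸ haq)
      rcases hd with rfl | hd <;> rcases hd' with hd' | hd'
      · exact hne hd'
      · exact (mem_litsAfter.1 (hTL hd')).1 rfl
      · have := mem_litsAfter.1 (hTL hd)
        refine this.1 ?_
        rw [← h.invol this.2.2, hd']
      · exact hT d hd hd'
    · intro a ha
      by_cases haq : N a q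
      · exact ⟨q, Finset.mem_insert_self _ _, haq⟩
      · obtain ⟨d, hd, had⟩ := hTA a (Finset.mem_filter.2 ⟨ha, haq⟩)
        exact ⟨d, Finset.mem_insert_of_mem hd, had⟩
  · rintro ⟨T, hTL, hT, hTA⟩
    have hqT := hforced T hTL hT hTA
    refine ⟨T.erase q, ?_, ?_, ?_⟩
    · intro d hd
      obtain ⟨h1, h2⟩ := Finset.mem_erase.1 hd
      exact mem_litsAfter.2 ⟨fun e => hT q hqT (e ▸ h2), h1, hTL h2⟩
    · exact fun d hd hd' => hT d (Finset.mem_of_mem_erase hd) (Finset.mem_of_mem_erase hd')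
    · intro a ha
      obtain ⟨ha, haq⟩ := Finset.mem_filter.1 ha
      obtain ⟨d, hd, had⟩ := hTA a ha
      exact ⟨d, Finset.mem_erase.2 ⟨by rintro rfl; exact haq had, hd⟩, had⟩

theorem choosable_after_iff_of_single (h : ChoiceSystem N τ A L) {a q : V} (ha : a ∈ A)
    (h1 : (lits N L a).card = 1) (hq : q ∈ lits N L a) :
    Choosable N τ (clausesAfter N A q) (litsAfter τ L q) ↔ Choosable N τ A L := by
  have hq' := mem_lits.1 hq
  refine choosable_after_iff h hq'.1 ⟨a, ha, hq'.2⟩ fun T hTL _ hTA => ?_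
  obtain ⟨d, hd, had⟩ := hTA a ha
  exact Finset.card_le_one.1 h1.le d (mem_lits.2 ⟨hTL hd, had⟩) q hq ▸ hd

/-- Suppose a solution avoids `q` and hence uses the other literal `p` of `a`. A further clause `b`
of `q` does not contain `p`, so it is hit by some third literal `r`. By `partner`, the mate of `r`
can only occur in `a`; so this mate is `p` or `q`, and both are impossible. -/
theorem choosable_after_iff_of_big (h : ChoiceSystem N τ A L) {a q : V} (ha : a ∈ A)
    (h2 : (lits N L a).card = 2) (h1 : (bigLits N A L a).card = 1) (hq : q ∈ bigLits N A L a) :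
    Choosable N τ (clausesAfter N A q) (litsAfter τ L q) ↔ Choosable N τ A L := by
  have hq' := (mem_bigLits.1 hq).1
  refine choosable_after_iff h hq'.1 ⟨a, ha, hq'.2⟩ fun T hTL hT hTA => ?_
  by_contra hqT
  obtain ⟨p, hp, hap⟩ := hTA a ha
  have hpq : p ≠ q := by rintro rfl; exact hqT hp
  have hlits : ∀ r ∈ L, N a r → r = p ∨ r = q := by
    intro r hr har
    by_contra! hne
    have : ({p, q, r} : Finset V) ⊆ lits N L a := by
      intro d hd
      simp only [Finset.mem_insert, Finset.mem_singleton] at hd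
      rcases hd with rfl | rfl | rfl
      exacts [mem_lits.2 ⟨hTL hp, hap⟩, mem_lits.2 hq', mem_lits.2 ⟨hr, har⟩]
    have := Finset.card_le_card this
    rw [h2, Finset.card_eq_three.2 ⟨p, q, r, hpq, hne.1.symm, hne.2.symm, rfl⟩] at this
    omega
  obtain ⟨b, hb, hba, hbq⟩ := exists_ne_of_mem_bigLits hq
  have hpb : ¬N b p := fun hbp => hpq (Finset.card_le_one.1 h1.le p
    (mem_bigLits_of_ne (hTL hp) ha hb hba.symm hap hbp) q hq)
  obtain ⟨r, hr, hbr⟩ := hTA b hb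
  have hrq : r ≠ q := by rintro rfl; exact hqT hr
  have hτrq : τ r ≠ q := by
    rintro e
    exact h.disj hb (hTL hr) hbr (e ▸ hbq)
  obtain ⟨c, hc⟩ := h.nonempty (h.mem (hTL hr))
  -- The field `partner` is applied to `r` and `q` with `b` as their common clause; the option `c =
  -- b` fails because `b` would contain both `r` and its mate.
  have hca : c = a := by
    rcases h.partner (hTL hr) hq'.1 hrq hτrq hbr hc hbq hq'.2 hba.symm with rfl | e
    · exact absurd hc (h.disj hb (hTL hr) hbr)
    · exact e
  rw [hca] at hc
  rcases hlits _ (h.mem (hTL hr)) hc with e | e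
  · exact hT r hr (e ▸ hp)
  · exact hτrq e

/-- By `common`, two big literals of `a` have the same other clause; for `d = e` a second big
literal mediates. Thus a clause with at least two big literals has a single twin that contains all
of them. -/
theorem eq_of_mem_bigLits (h : ChoiceSystem N τ A L) {a b c d : V}
    (h2 : 2 ≤ (bigLits N A L a).card) (hd : d ∈ bigLits N A L a) (hb : N b d) (hba : b ≠ a)
    {e : V} (he : e ∈ bigLits N A L a) (hc : N c e) (hca : c ≠ a) : b = c := by
  have hd' := (mem_bigLits.1 hd).1
  have he' := (mem_bigLits.1 he).1
  by_cases hde : d = e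
  · subst hde
    obtain ⟨f, hf, hfd⟩ := Finset.exists_mem_ne h2 d
    have hf' := (mem_bigLits.1 hf).1
    obtain ⟨g, -, hga, hg⟩ := exists_ne_of_mem_bigLits hf
    exact (h.common hd'.1 hf'.1 hfd.symm hb hd'.2 hf'.2 hg hba hga).trans
      (h.common hd'.1 hf'.1 hfd.symm hc hd'.2 hf'.2 hg hca hga).symm
  · exact h.common hd'.1 he'.1 hde hb hd'.2 he'.2 hc hba hca

/-- Keep one clause of each pair of twins and give every kept clause at least two literals, with no
literal given to two clauses. Every kept clause then meets at least two pairs `{d, τ d}` and every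
pair meets at most two kept clauses, so Hall's condition holds. -/
theorem choosable_of_two_le [LinearOrder V] (h : ChoiceSystem N τ A L)
    (hlits : ∀ a ∈ A, 2 ≤ (lits N L a).card)
    (hbig : ∀ a ∈ A, (lits N L a).card = 2 → (bigLits N A L a).card ≠ 1) :
    Choosable N τ A L := by
  classical
  -- With at most one big literal, the others belong to this clause alone, and the hypotheses leave
  -- at least two of them. Otherwise the big literals are used, which only the twin shares.
  set E : V → Finset V := fun a =>
    if (bigLits N A L a).card ≤ 1 then lits N L a \ bigLits N A L a else bigLits N A L a with hE
  -- The linear order only serves to select one clause from each pair of twins; clauses with fewer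
  -- than two big literals always remain.
  set R : Finset V := A.filter fun a => 2 ≤ (bigLits N A L a).card →
    ∀ b ∈ A, ∀ q ∈ bigLits N A L a, N b q → a ≤ b with hR
  have hRA : ∀ {r}, r ∈ R → r ∈ A := fun hr => (Finset.mem_filter.1 hr).1
  have hsub : ∀ a, bigLits N A L a ⊆ lits N L a := fun a => Finset.filter_subset _ _
  have hEl : ∀ {a d}, d ∈ E a → d ∈ L ∧ N a d := by
    intro a d hd
    simp only [hE] at hd
    split_ifs at hd
    · exact mem_lits.1 (Finset.mem_sdiff.1 hd).1
    · exact mem_lits.1 (hsub a hd)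
  have hEcard : ∀ r ∈ A, 2 ≤ (E r).card := by
    intro r hr
    simp only [hE]
    split_ifs with h1
    · have h3 := Finset.card_sdiff_add_card_eq_card (hsub r)
      have h4 := hlits r hr
      have h5 := hbig r hr
      omega
    · omega
  have huniq : ∀ r ∈ R, ∀ r' ∈ R, ∀ d, d ∈ E r → d ∈ E r' → r = r' := by
    intro r hr r' hr' d hd hd'
    by_contra hne
    have h1 := hEl hd
    have h2 := hEl hd'
    have b1 := mem_bigLits_of_ne h1.1 (hRA hr) (hRA hr') hne h1.2 h2.2
    have b2 := mem_bigLits_of_ne h1.1 (hRA hr') (hRA hr) (Ne.symm hne) h2.2 h1.2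
    have c1 : 2 ≤ (bigLits N A L r).card := by
      by_contra hlt
      simp only [hE, if_pos (show (bigLits N A L r).card ≤ 1 by omega)] at hd
      exact (Finset.mem_sdiff.1 hd).2 b1
    have c2 : 2 ≤ (bigLits N A L r').card := by
      by_contra hlt
      simp only [hE, if_pos (show (bigLits N A L r').card ≤ 1 by omega)] at hd'
      exact (Finset.mem_sdiff.1 hd').2 b2
    exact hne (le_antisymm ((Finset.mem_filter.1 hr).2 c1 r' (hRA hr') d b1 h2.2)
      ((Finset.mem_filter.1 hr').2 c2 r (hRA hr) d b2 h1.2))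
  -- Working with unordered pairs makes distinct representatives yield literals that are not mates.
  set t : {r // r ∈ R} → Finset (Sym2 V) := fun r => (E r).image fun d => s(d, τ d) with ht
  have htcard : ∀ r, 2 ≤ (t r).card := by
    intro r
    rw [ht, Finset.card_image_of_injOn]
    · exact hEcard r (hRA r.2)
    · intro d hd e he hde
      have hd' := hEl hd
      have he' := hEl he
      rcases Sym2.eq_iff.1 hde with h1 | h1
      · exact h1.1
      · exact absurd (h1.1 ▸ hd'.2) (h.disj (hRA r.2) he'.1 he'.2)
  have hhall : ∀ s : Finset {r // r ∈ R}, s.card ≤ (s.biUnion t).card := by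
    intro s
    -- Count incidences between clauses and pairs: at least two per clause, at most two per pair.
    have := Finset.card_mul_le_card_mul (s := s) (t := s.biUnion t) (m := 2) (n := 2)
      (fun r z => z ∈ t r) ?_ ?_
    · omega
    · intro r hr
      refine (htcard r).trans (Finset.card_le_card fun z hz => ?_)
      exact Finset.mem_filter.2 ⟨Finset.mem_biUnion.2 ⟨r, hr, hz⟩, hz⟩
    · intro z hz
      obtain ⟨r, -, hz⟩ := Finset.mem_biUnion.1 hz
      obtain ⟨d, hd, rfl⟩ := Finset.mem_image.1 hz
      have hle : ∀ e, (s.filter fun r : {r // r ∈ R} => e ∈ E r).card ≤ 1 := by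
        intro e
        refine Finset.card_le_one.2 fun r hr r' hr' => Subtype.ext ?_
        exact huniq r r.2 r' r'.2 e (Finset.mem_filter.1 hr).2 (Finset.mem_filter.1 hr').2
      calc _ ≤ ((s.filter fun r : {r // r ∈ R} => d ∈ E r) ∪ (s.filter fun r : {r // r ∈ R} => τ d ∈ E r)).card := by
            refine Finset.card_le_card fun r hr => ?_
            obtain ⟨hrs, hr⟩ := Finset.mem_filter.1 hr
            obtain ⟨e, he, hed⟩ := Finset.mem_image.1 hr
            rw [Finset.mem_union, Finset.mem_filter, Finset.mem_filter]
            rcases Sym2.eq_iff.1 hed with h1 | h1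
            · exact Or.inl ⟨hrs, h1.1 ▸ he⟩
            · exact Or.inr ⟨hrs, h1.1 ▸ he⟩
        _ ≤ 1 + 1 := (Finset.card_union_le _ _).trans (Nat.add_le_add (hle d) (hle _))
  obtain ⟨f, hf, hft⟩ := (Finset.all_card_le_biUnion_card_iff_exists_injective t).1 hhall
  choose l hl hlf using fun r => Finset.mem_image.1 (hft r)
  refine ⟨Finset.univ.image l, ?_, ?_, ?_⟩
  · intro d hd
    obtain ⟨r, -, rfl⟩ := Finset.mem_image.1 hd
    exact (hEl (hl r)).1
  · intro d hd hd'
    obtain ⟨r, -, rfl⟩ := Finset.mem_image.1 hd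
    obtain ⟨r', -, hr'⟩ := Finset.mem_image.1 hd'
    have hrr : r = r' := by
      refine hf ?_
      rw [← hlf r, ← hlf r', hr', h.invol (hEl (hl r)).1]
      exact Sym2.eq_swap
    subst hrr
    have := hEl (hl r)
    exact h.disj (hRA r.2) this.1 this.2 (hr' ▸ this.2)
  · intro a ha
    by_cases haR : a ∈ R
    · exact ⟨l ⟨a, haR⟩, Finset.mem_image_of_mem _ (Finset.mem_univ _), (hEl (hl ⟨a, haR⟩)).2⟩
    · have haR' := haR
      simp only [hR, Finset.mem_filter, ha, true_and] at haR'
      push Not at haR'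
      -- The omitted clause `a` has a smaller twin `b`. The literal chosen for `b` is big, and its
      -- other clause is `a`.
      obtain ⟨h2, b, hb, q, hq, hbq, hba⟩ := haR'
      have hkey : ∀ e ∈ bigLits N A L a, e ∈ bigLits N A L b := by
        intro e he
        obtain ⟨c, hc, hca, hce⟩ := exists_ne_of_mem_bigLits he
        obtain rfl := eq_of_mem_bigLits h h2 hq hbq hba.ne he hce hca
        have := (mem_bigLits.1 he).1
        exact mem_bigLits_of_ne this.1 hb ha hba.ne hce this.2
      have h2b : 2 ≤ (bigLits N A L b).card := h2.trans (Finset.card_le_card hkey)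
      have haq := (mem_bigLits.1 hq).1.2
      have hbR : b ∈ R := by
        refine Finset.mem_filter.2 ⟨hb, fun _ c hc e he hce => ?_⟩
        by_cases hcb : c = b
        · exact hcb.ge
        · rw [eq_of_mem_bigLits h h2b he hce hcb (hkey q hq) haq hba.ne']
          exact hba.le
      refine ⟨l ⟨b, hbR⟩, Finset.mem_image_of_mem _ (Finset.mem_univ _), ?_⟩
      have hlb := hl ⟨b, hbR⟩
      simp only [hE, if_neg (show ¬(bigLits N A L b).card ≤ 1 by omega)] at hlb
      obtain ⟨c, -, hcb, hc⟩ := exists_ne_of_mem_bigLits hlb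
      exact eq_of_mem_bigLits h h2b hlb hc hcb (hkey q hq) haq hba.ne' ▸ hc

end Choice

/-! ## Reasoning about programs -/

namespace RAM

namespace State

variable (s : State)

@[simp] theorem setReg_reg (i v j : ℕ) : (s.setReg i v).reg j = if j = i then v else s.reg j := by
  simp [setReg, Function.update_apply]

@[simp] theorem setReg_mem (i v : ℕ) : (s.setReg i v).mem = s.mem := rfl

@[simp] theorem setMem_reg (a i v : ℕ) : (s.setMem a i v).reg = s.reg := rfl

@[simp] theorem setMem_mem (a i v b : ℕ) :
    (s.setMem a i v).mem b = if b = a then Function.update (s.mem a) i v else s.mem b := by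
  simp [setMem, Function.update_apply]

end State

infixr:60 " ;; " => Program.seq

namespace Program

/-- The program may write into register `r`. -/
def writesReg : Program → ℕ → Bool
  | skip, _ => false
  | const i _, r => r == i
  | copy i _, r => r == i
  | add i _ _, r => r == i
  | sub i _ _, r => r == i
  | load i _ _, r => r == i
  | store _ _ _, _ => false
  | seq p q, r => p.writesReg r || q.writesReg r
  | ite _ p q, r => p.writesReg r || q.writesReg r
  | .while _ p, r => p.writesReg r

/-- The program may write into array `b`. -/
def writesMem : Program → ℕ → Bool
  | store a _ _, b => b == a
  | seq p q, b => p.writesMem b || q.writesMem b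
  | ite _ p q, b => p.writesMem b || q.writesMem b
  | .while _ p, b => p.writesMem b
  | _, _ => false

/-- A bound for the number of steps of a program without loops. -/
def size : Program → ℕ
  | seq p q => p.size + q.size
  | ite _ p q => p.size + q.size + 1
  | _ => 1

/-- The weakest precondition of a program without loops. -/
def wp (W : ℕ) : Program → (State → Prop) → State → Prop
  | skip, Q, s => Q s
  | const i c, Q, s => c < W ∧ Q (s.setReg i c)
  | copy i j, Q, s => Q (s.setReg i (s.reg j))
  | add i j k, Q, s => s.reg j + s.reg k < W ∧ Q (s.setReg i (s.reg j + s.reg k))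
  | sub i j k, Q, s => Q (s.setReg i (s.reg j - s.reg k))
  | load i a j, Q, s => Q (s.setReg i (s.mem a (s.reg j)))
  | store a i j, Q, s => Q (s.setMem a (s.reg i) (s.reg j))
  | seq p q, Q, s => p.wp W (q.wp W Q) s
  | ite b p q, Q, s => (b.Holds s → p.wp W Q s) ∧ (¬b.Holds s → q.wp W Q s)
  | .while _ _, _, _ => False

end Program

/-- `s'` agrees with `s` wherever the program `p` does not write. -/
structure Frame (p : Program) (s s' : State) : Prop where
  reg : ∀ r, p.writesReg r = false → s'.reg r = s.reg r
  mem : ∀ a, p.writesMem a = false → s'.mem a = s.mem a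

theorem Frame.refl (p : Program) (s : State) : Frame p s s := ⟨fun _ _ => rfl, fun _ _ => rfl⟩

theorem Frame.trans {p : Program} {s s' s'' : State} (h : Frame p s s') (h' : Frame p s' s'') :
    Frame p s s'' :=
  ⟨fun r hr => (h'.reg r hr).trans (h.reg r hr), fun a ha => (h'.mem a ha).trans (h.mem a ha)⟩

theorem Frame.mono {p q : Program} {s s' : State} (h : Frame p s s')
    (hr : ∀ r, q.writesReg r = false → p.writesReg r = false)
    (hm : ∀ a, q.writesMem a = false → p.writesMem a = false) : Frame q s s' :=
  ⟨fun r h' => h.reg r (hr r h'), fun a h' => h.mem a (hm a h')⟩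

/-- The sets of written registers and arrays are computed from the program text, so for concrete
programs the side conditions of this frame rule hold by `rfl`. -/
theorem Exec.frame {W : ℕ} {p : Program} {s s' : State} {t : ℕ} (h : Exec W p s t s') :
    Frame p s s' := by
  induction h with
  | skip => exact Frame.refl _ _
  | seq hp hq ihp ihq =>
    refine (ihp.mono ?_ ?_).trans (ihq.mono ?_ ?_) <;>
      simp +contextual [Program.writesReg, Program.writesMem]
  | ite_true hb hp ih =>
    refine ih.mono ?_ ?_ <;> simp +contextual [Program.writesReg, Program.writesMem]
  | ite_false hb hp ih =>
    refine ih.mono ?_ ?_ <;> simp +contextual [Program.writesReg, Program.writesMem]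
  | while_true hb hp hw ihp ihw =>
    exact Frame.trans (ihp.mono (fun _ h => h) fun _ h => h) ihw
  | while_false => exact Frame.refl _ _
  | _ => constructor <;> simp +contextual [Program.writesReg, Program.writesMem]

/-- Started in `s`, the program halts after at most `T` steps in a state with property `Q`. -/
def Runs (W : ℕ) (p : Program) (s : State) (T : ℕ) (Q : State → Prop) : Prop :=
  ∃ t s', Exec W p s t s' ∧ t ≤ T ∧ Q s'

variable {W : ℕ} {p q : Program} {s : State} {T T' : ℕ} {Q Q' : State → Prop}

theorem Runs.mono (h : Runs W p s T Q) (hT : T ≤ T') (hQ : ∀ s', Q s' → Q' s') :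
    Runs W p s T' Q' := by
  obtain ⟨t, s', h1, h2, h3⟩ := h
  exact ⟨t, s', h1, h2.trans hT, hQ _ h3⟩

theorem Runs.framed (h : Runs W p s T Q) : Runs W p s T fun s' => Q s' ∧ Frame p s s' := by
  obtain ⟨t, s', h1, h2, h3⟩ := h
  exact ⟨t, s', h1, h2, h3, h1.frame⟩

theorem Runs.seq (h : Runs W p s T fun s' => Frame p s s' → Runs W q s' T' Q) :
    Runs W (p ;; q) s (T + T') Q := by
  obtain ⟨t, s', h1, h2, h3⟩ := h
  obtain ⟨t', s'', h1', h2', h3'⟩ := h3 h1.frame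
  exact ⟨t + t', s'', h1.seq h1', Nat.add_le_add h2 h2', h3'⟩

theorem runs_of_wp (h : p.wp W Q s) : Runs W p s p.size Q := by
  induction p generalizing s Q with
  | skip => exact ⟨_, _, .skip s, le_rfl, h⟩
  | const i c => exact ⟨_, _, .const s i c h.1, le_rfl, h.2⟩
  | copy i j => exact ⟨_, _, .copy s i j, le_rfl, h⟩
  | add i j k => exact ⟨_, _, .add s i j k h.1, le_rfl, h.2⟩
  | sub i j k => exact ⟨_, _, .sub s i j k, le_rfl, h⟩
  | load i a j => exact ⟨_, _, .load s i a j, le_rfl, h⟩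
  | store a i j => exact ⟨_, _, .store s a i j, le_rfl, h⟩
  | seq p q ihp ihq => exact Runs.seq ((ihp h).mono le_rfl fun s' h' _ => ihq h')
  | ite b p q ihp ihq =>
    by_cases hb : b.Holds s
    · obtain ⟨t, s', h1, h2, h3⟩ := ihp (h.1 hb)
      exact ⟨t + 1, s', .ite_true hb h1, by simp only [Program.size]; omega, h3⟩
    · obtain ⟨t, s', h1, h2, h3⟩ := ihq (h.2 hb)
      exact ⟨t + 1, s', .ite_false hb h1, by simp only [Program.size]; omega, h3⟩
  | _ => exact h.elim

theorem Runs.wp_seq (h : p.wp W (fun s' => Frame p s s' → Runs W q s' T Q) s) :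
    Runs W (p ;; q) s (p.size + T) Q :=
  Runs.seq (runs_of_wp h)

theorem Runs.ite {b : Test} (h : b.Holds s → Runs W p s T Q) (h' : ¬b.Holds s → Runs W q s T Q) :
    Runs W (.ite b p q) s (T + 1) Q := by
  by_cases hb : b.Holds s
  · obtain ⟨t, s', h1, h2, h3⟩ := h hb
    exact ⟨t + 1, s', .ite_true hb h1, by omega, h3⟩
  · obtain ⟨t, s', h1, h2, h3⟩ := h' hb
    exact ⟨t + 1, s', .ite_false hb h1, by omega, h3⟩

theorem Runs.while_true {b : Test} (hb : b.Holds s)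
    (h : Runs W p s T fun s' => Runs W (.while b p) s' T' Q) :
    Runs W (.while b p) s (T + T' + 1) Q := by
  obtain ⟨t, s', h1, h2, h3⟩ := h
  obtain ⟨t', s'', h1', h2', h3'⟩ := h3
  exact ⟨t + t' + 1, s'', .while_true hb h1 h1', by omega, h3'⟩

theorem Runs.while_false {b : Test} (hb : ¬b.Holds s) (h : Q s) : Runs W (.while b p) s 1 Q :=
  ⟨1, s, .while_false hb, le_rfl, h⟩

/-! ### Loops over the numbers below a bound -/

/-- Increase register `i` by one. Register `4` serves as a scratch register. -/
def incr (i : ℕ) : Program := .const 4 1 ;; .add i i 4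

/-- `for i = 0, …, N - 1 do p`. -/
def forLoop (i N : ℕ) (p : Program) : Program :=
  .const i 0 ;; .while (.lt i N) (p ;; incr i)

/-- Induction on the number `m` of iterations left. The postcondition of a step describes the state
after `incr i`, which also overwrites scratch register `4`. -/
theorem runs_forLoop_aux {i N n : ℕ} (hi4 : i ≠ 4) (hN4 : N ≠ 4) (hiN : i ≠ N)
    (hpi : p.writesReg i = false) (hpN : p.writesReg N = false) (hW : n < W) (hn : s.reg N = n)
    (I : ℕ → State → Prop) (c : ℕ → ℕ)
    (hstep : ∀ k < n, ∀ s', Frame (forLoop i N p) s s' → s'.reg i = k → I k s' →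
      Runs W p s' (c k) fun s'' => I (k + 1) ((s''.setReg 4 1).setReg i (k + 1)))
    (m k : ℕ) (hmk : k + m = n) (s' : State) (hs' : Frame (forLoop i N p) s s')
    (hk : s'.reg i = k) (hI : I k s') :
    Runs W (.while (.lt i N) (p ;; incr i)) s' (∑ l ∈ Finset.Ico k n, (c l + 3) + 1)
      fun s'' => I n s'' ∧ Frame (forLoop i N p) s s'' := by
  have hwN : (forLoop i N p).writesReg N = false := by
    simp [forLoop, incr, Program.writesReg, hpN, hN4, hiN.symm]
  induction m generalizing k s' with
  | zero =>
    obtain rfl : k = n := by omega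
    refine (Runs.while_false ?_ ⟨hI, hs'⟩).mono (by omega) fun _ h => h
    simp [Test.Holds, hk, hs'.reg N hwN, hn]
  | succ m ih =>
    have hkn : k < n := by omega
    rw [Finset.sum_eq_sum_Ico_succ_bot hkn]
    refine (Runs.while_true (T := c k + 2) (T' := ∑ l ∈ Finset.Ico (k + 1) n, (c l + 3) + 1) ?_
      (Runs.seq ?_)).mono (by omega) fun _ h => h
    · simp [Test.Holds, hk, hs'.reg N hwN, hn, hkn]
    refine (hstep k hkn s' hs' hk hI).mono le_rfl fun s'' hI' hf => ?_
    have hi'' : s''.reg i = k := (hf.reg i hpi).trans hk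
    refine runs_of_wp (p := incr i) ?_
    simp only [incr, Program.wp, State.setReg_reg, if_neg hi4, if_true, hi'']
    refine ⟨by omega, by omega, ih (k + 1) (by omega) _ ?_ (by simp) hI'⟩
    refine hs'.trans ?_
    constructor
    · intro r hr
      simp only [forLoop, incr, Program.writesReg, Bool.or_eq_false_iff, beq_eq_false_iff_ne] at hr
      simp [hr.2.2.1, hr.1, hf.reg r hr.2.1]
    · intro a ha
      simp only [forLoop, incr, Program.writesMem, Bool.or_false, Bool.false_or] at ha
      simp [hf.mem a ha]

theorem runs_forLoop {i N n : ℕ} (hi4 : i ≠ 4) (hN4 : N ≠ 4) (hiN : i ≠ N)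
    (hpi : p.writesReg i = false) (hpN : p.writesReg N = false) (hW : n < W) (hn : s.reg N = n)
    (I : ℕ → State → Prop) (c : Fin n → ℕ) (h0 : I 0 (s.setReg i 0))
    (hstep : ∀ v : Fin n, ∀ s', Frame (forLoop i N p) s s' → s'.reg i = v → I v s' →
      Runs W p s' (c v) fun s'' => I (v + 1) ((s''.setReg 4 1).setReg i (v + 1))) :
    Runs W (forLoop i N p) s (∑ v, c v + 3 * n + 2)
      fun s' => I n s' ∧ Frame (forLoop i N p) s s' := by
  have hfr : Frame (forLoop i N p) s (s.setReg i 0) := by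
    constructor
    · intro r hr
      simp only [forLoop, incr, Program.writesReg, Bool.or_eq_false_iff, beq_eq_false_iff_ne] at hr
      simp [hr.1]
    · intro a _
      rfl
  have hsum : ∑ l ∈ Finset.Ico 0 n, ((if h : l < n then c ⟨l, h⟩ else 0) + 3)
      = ∑ v, c v + 3 * n := by
    rw [Finset.sum_add_distrib, Nat.Ico_zero_eq_range,
      ← Fin.sum_univ_eq_sum_range (fun l => if h : l < n then c ⟨l, h⟩ else 0) n]
    simp [mul_comm]
  refine (Runs.seq (T := 1) (T' := ∑ v, c v + 3 * n + 1)
    ⟨1, _, .const s i 0 (by omega), le_rfl, fun _ => ?_⟩).mono (by omega) fun _ h => h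
  rw [← hsum]
  refine runs_forLoop_aux hi4 hN4 hiN hpi hpN hW hn I (fun l => if h : l < n then c ⟨l, h⟩ else 0) ?_ n
    0 (by omega) (s.setReg i 0) hfr (by simp) h0
  intro k hk s' hf hik hI
  simp only [dif_pos hk]
  exact hstep ⟨k, hk⟩ s' hf hik hI

/-- A loop that stores a function of `v` into the cell `v` of an array, for every `v`. -/
theorem runs_map {i N n : ℕ} (hi4 : i ≠ 4) (hN4 : N ≠ 4) (hiN : i ≠ N)
    (hpi : p.writesReg i = false) (hpN : p.writesReg N = false) (hW : n < W) (hn : s.reg N = n)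
    (arr : ℕ) (F : Fin n → ℕ) (c : Fin n → ℕ)
    (hstep : ∀ v : Fin n, ∀ s', Frame (forLoop i N p) s s' → s'.reg i = v →
      Runs W p s' (c v) fun s'' => s''.mem arr = Function.update (s'.mem arr) v (F v)) :
    Runs W (forLoop i N p) s (∑ v, c v + 3 * n + 2)
      fun s' => (∀ v : Fin n, s'.mem arr v = F v) ∧ Frame (forLoop i N p) s s' := by
  refine (runs_forLoop hi4 hN4 hiN hpi hpN hW hn
    (fun k s' => ∀ v : Fin n, v < k → s'.mem arr v = F v) c (by simp) ?_).mono le_rfl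
    fun s' h => ⟨fun v => h.1 v v.2, h.2⟩
  intro v s' hf hv hI
  refine (hstep v s' hf hv).mono le_rfl fun s'' h u hu => ?_
  simp only [State.setReg_mem, h, Function.update_apply]
  split_ifs with huv
  · rw [Fin.ext huv]
  · exact hI u (by omega)

/-! ### Loops over adjacency lists -/

/-- The arrays `0` and `1` hold the adjacency lists. -/
structure HoldsLists {n : ℕ} (adj : Fin n → List (Fin n)) (s : State) : Prop where
  offset : ∀ i ≤ n, s.mem 0 i = adjOffset adj i
  concat : ∀ i, s.mem 1 i = (adjConcat adj).getD i 0

/-- For each element `w` of the adjacency list of the vertex in register `u` do `p`. The registers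
`j` and `e` hold the current position and the end of the list. -/
def adjLoop (u j e w : ℕ) (p : Program) : Program :=
  (.load j 0 u ;; .const 4 1 ;; .add e u 4 ;; .load e 0 e) ;;
    .while (.lt j e) (.load w 1 j ;; p ;; incr j)

/-- The list of `v` is a contiguous block, and its end is the next offset; for the last vertex this
is the total length, stored at address `n`. -/
theorem exists_adjConcat_eq {n : ℕ} (adj : Fin n → List (Fin n)) (v : Fin n) :
    ∃ l₁ l₂, adjConcat adj = l₁ ++ ((adj v).map Fin.val ++ l₂) ∧ l₁.length = adjOffset adj v ∧
      adjOffset adj (v + 1) = adjOffset adj v + (adj v).length := by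
  obtain ⟨a, b, hab⟩ := List.append_of_mem (List.mem_finRange v)
  have hp := List.pairwise_lt_finRange n
  rw [hab, List.pairwise_append, List.pairwise_cons] at hp
  have hoff : ∀ i, adjOffset adj i =
      ((a ++ v :: b).map fun u : Fin n => if u.val < i then (adj u).length else 0).sum := by
    intro i
    rw [← hab, adjOffset, Fin.sum_univ_def]
  have ha : ∀ i, v.val ≤ i → (a.map fun u : Fin n => if u.val < i then (adj u).length else 0)
      = a.map fun u => (adj u).length := by
    intro i hi
    refine List.map_congr_left fun u hu => if_pos ?_
    have : u < v := hp.2.2 u hu v List.mem_cons_self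
    omega
  have hb : ∀ i, i ≤ v.val + 1 →
      (b.map fun u : Fin n => if u.val < i then (adj u).length else 0).sum = 0 := by
    intro i hi
    refine List.sum_eq_zero fun x hx => ?_
    obtain ⟨u, hu, rfl⟩ := List.mem_map.1 hx
    have : v < u := hp.2.1.1 u hu
    exact if_neg (by omega)
  refine ⟨a.flatMap fun u => (adj u).map Fin.val, b.flatMap fun u => (adj u).map Fin.val, ?_, ?_, ?_⟩
  · rw [adjConcat, hab, List.flatMap_append, List.flatMap_cons]
  · rw [hoff, List.map_append, List.sum_append, List.map_cons, List.sum_cons, ha _ le_rfl,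
      hb _ (by omega), List.length_flatMap]
    simp
  · rw [hoff, hoff, List.map_append, List.sum_append, List.map_cons, List.sum_cons,
      List.map_append, List.sum_append, List.map_cons, List.sum_cons, ha _ le_rfl,
      ha _ (by omega), hb _ (by omega), hb _ (by omega)]
    simp

theorem adjOffset_le {n : ℕ} (adj : Fin n → List (Fin n)) (i : ℕ) :
    adjOffset adj i ≤ ∑ u, (adj u).length := by
  refine Finset.sum_le_sum fun u _ => ?_
  split_ifs <;> omega

/-- Induction on the unread suffix `l'`, while `I` speaks of the prefix already read. Hypothesis
`hI` makes `I` insensitive to the bookkeeping registers of the loop. -/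
theorem runs_adjLoop_aux {n : ℕ} {adj : Fin n → List (Fin n)} {u j e w : ℕ} {v : Fin n}
    (hj4 : j ≠ 4) (he4 : e ≠ 4) (hje : j ≠ e) (hjw : j ≠ w) (hew : e ≠ w)
    (hpj : p.writesReg j = false) (hpe : p.writesReg e = false)
    (hp1 : p.writesMem 1 = false) (hs : HoldsLists adj s)
    (hWM : ∑ u, (adj u).length < W) (h1W : 1 < W)
    (I : List (Fin n) → State → Prop) (c : ℕ)
    (hI : ∀ l s r x, r = 4 ∨ r = j ∨ r = e ∨ r = w → I l s → I l (s.setReg r x))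
    (hstep : ∀ (l : List (Fin n)) (w' : Fin n) (l' : List (Fin n)), adj v = l ++ w' :: l' → ∀ s', Frame (adjLoop u j e w p) s s' →
      s'.reg w = w'.val → I l s' → Runs W p s' c (I (l ++ [w'])))
    (l' l : List (Fin n)) (hl : adj v = l ++ l') (s' : State)
    (hs' : Frame (adjLoop u j e w p) s s')
    (hj : s'.reg j = adjOffset adj v + l.length) (he : s'.reg e = adjOffset adj (v + 1))
    (hIl : I l s') :
    Runs W (.while (.lt j e) (.load w 1 j ;; p ;; incr j)) s' ((c + 4) * l'.length + 1)
      fun s'' => I (adj v) s'' ∧ Frame (adjLoop u j e w p) s s'' := by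
  obtain ⟨l₁, l₂, hc, hl₁, hoff⟩ := exists_adjConcat_eq adj v
  induction l' generalizing l s' with
  | nil =>
    rw [List.append_nil] at hl
    refine (Runs.while_false ?_ ⟨hl ▸ hIl, hs'⟩).mono (by omega) fun _ h => h
    simp [Test.Holds, hj, he, hoff, hl]
  | cons w' l' ih =>
    have hlen : (adj v).length = l.length + l'.length + 1 := by
      rw [hl]; simp; omega
    have hw' : s'.mem 1 (s'.reg j) = w' := by
      have hw1 : (adjLoop u j e w p).writesMem 1 = false := by
        simp [adjLoop, incr, Program.writesMem, hp1]
      rw [hs'.mem 1 hw1, hs.concat, hj, hc, hl, ← hl₁]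
      simp
    refine (Runs.while_true (T := 1 + (c + 2)) (T' := (c + 4) * l'.length + 1) ?_
      (Runs.wp_seq (p := .load w 1 j) ?_)).mono
      (by simp only [List.length_cons]; ring_nf; omega) fun _ h => h
    · simp only [Test.Holds, hj, he, hoff]
      omega
    intro hf0
    have hF0 : Frame (adjLoop u j e w p) s' (s'.setReg w (s'.mem 1 (s'.reg j))) := by
      refine hf0.mono ?_ ?_ <;>
        simp +contextual [adjLoop, Program.writesReg, Program.writesMem]
    refine Runs.seq ((hstep l w' l' hl _ (hs'.trans hF0) (by simp [hw'])
      (hI _ _ _ _ (by simp) hIl)).mono le_rfl fun s'' hI' hf => ?_)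
    have hj'' : s''.reg j = adjOffset adj v + l.length := by
      rw [hf.reg j hpj]; simp [hjw, hj]
    have he'' : s''.reg e = adjOffset adj (v + 1) := by
      rw [hf.reg e hpe]; simp [hew, he]
    have hle := adjOffset_le adj (v + 1)
    refine runs_of_wp (p := incr j) ?_
    simp only [incr, Program.wp, State.setReg_reg, if_neg hj4, if_true, hj'']
    refine ⟨h1W, by omega, ih (l ++ [w']) (by simp [hl]) _ ?_ ?_ ?_ ?_⟩
    · refine (hs'.trans hF0).trans ?_
      constructor
      · intro r hr
        simp only [adjLoop, incr, Program.writesReg, Bool.or_eq_false_iff, beq_eq_false_iff_ne] at hr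
        have hpr : p.writesReg r = false := by tauto
        have hr4 : r ≠ 4 := by tauto
        have hrj : r ≠ j := by tauto
        simp [hf.reg r hpr, hr4, hrj]
      · intro a ha
        simp only [adjLoop, incr, Program.writesMem, Bool.or_false, Bool.false_or] at ha
        simp [hf.mem a ha]
    · simp; omega
    · simp [he4, hje.symm, he'']
    · exact hI _ _ _ _ (by simp) (hI _ _ _ _ (by simp) hI')

/-- A loop over an adjacency list, with an invariant that depends on the elements processed. -/
theorem runs_adjLoop {n : ℕ} {adj : Fin n → List (Fin n)} {u j e w : ℕ} (v : Fin n)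
    (hv : s.reg u = v) (hs : HoldsLists adj s)
    (hreg : j ≠ 4 ∧ e ≠ 4 ∧ u ≠ 4 ∧ u ≠ j ∧ j ≠ e ∧ j ≠ w ∧ e ≠ w)
    (hwr : p.writesReg j = false ∧ p.writesReg e = false ∧ p.writesMem 1 = false)
    (hW : n + ∑ u, (adj u).length < W)
    (I : List (Fin n) → State → Prop) (c : ℕ)
    (hI : ∀ l s r x, r = 4 ∨ r = j ∨ r = e ∨ r = w → I l s → I l (s.setReg r x)) (h0 : I [] s)
    (hstep : ∀ (l : List (Fin n)) (w' : Fin n) (l' : List (Fin n)), adj v = l ++ w' :: l' → ∀ s', Frame (adjLoop u j e w p) s s' →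
      s'.reg w = w'.val → I l s' → Runs W p s' c (I (l ++ [w']))) :
    Runs W (adjLoop u j e w p) s ((c + 4) * (adj v).length + 5)
      fun s' => I (adj v) s' ∧ Frame (adjLoop u j e w p) s s' := by
  obtain ⟨hj4, he4, hu4, huj, hje, hjw, hew⟩ := hreg
  have hn : v.val < n := v.2
  refine (Runs.wp_seq (T := (c + 4) * (adj v).length + 1) ?_).mono
    (by simp only [Program.size]; omega) fun _ h => h
  simp only [Program.wp, State.setReg_reg, State.setReg_mem, if_neg hu4, if_neg huj, if_true, hv]
  refine ⟨by omega, by omega, fun hf => ?_⟩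
  refine runs_adjLoop_aux hj4 he4 hje hjw hew hwr.1 hwr.2.1 hwr.2.2 hs (by omega) (by omega) I c hI
    hstep (adj v) [] rfl _ ?_ ?_ ?_ ?_
  · refine hf.mono ?_ ?_ <;> simp +contextual [adjLoop, Program.writesReg, Program.writesMem]
  · simp [hje, hj4, hs.offset v hn.le]
  · simp [hs.offset (v + 1) hn]
  · exact hI _ _ _ _ (by simp) (hI _ _ _ _ (by simp) (hI _ _ _ _ (by simp)
      (hI _ _ _ _ (by simp) h0)))

end RAM

/-! ## The program: preparation -/

namespace RAM

open SimpleGraph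

variable {W : ℕ} {p q : Program} {s : State} {T T' : ℕ} {Q R : State → Prop}

theorem Runs.cut (h : Runs W p s T R) (h' : ∀ s', Frame p s s' → R s' → Runs W q s' T' Q) :
    Runs W (p ;; q) s (T + T') Q :=
  Runs.seq (h.mono le_rfl fun s' hR hf => h' s' hf hR)

/-- The number `1` or `0` according to whether `P` holds. -/
noncomputable def ind (P : Prop) : ℕ := by
  classical exact if P then 1 else 0

theorem ind_true {P : Prop} (h : P) : ind P = 1 := by simp [ind, h]

theorem ind_false {P : Prop} (h : ¬P) : ind P = 0 := by simp [ind, h]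

theorem ind_eq_one {P : Prop} : ind P = 1 ↔ P := by simp [ind]

theorem ind_congr {P P' : Prop} (h : P ↔ P') : ind P = ind P' := by rw [propext h]

theorem ind_le_one (P : Prop) : ind P ≤ 1 := by
  by_cases h : P <;> simp [ind, h]

theorem ind_inj {P P' : Prop} : ind P = ind P' ↔ (P ↔ P') := by
  by_cases h : P <;> by_cases h' : P' <;> simp [ind, h, h']

variable {n : ℕ}

/-- A number that stands for an optional vertex. -/
def enc : Option (Fin n) → ℕ
  | none => 0
  | some w => w + 1

/-- The state holds the adjacency lists, the number of vertices and the ends of the edge. -/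
structure HoldsInput (adj : Fin n → List (Fin n)) (x y : Fin n) (s : State) : Prop
    extends HoldsLists adj s where
  reg_zero : s.reg 0 = n
  reg_one : s.reg 1 = x
  reg_two : s.reg 2 = y

theorem HoldsLists.frame {adj : Fin n → List (Fin n)} {s' : State} (h : HoldsLists adj s)
    (hf : Frame p s s') (hp : p.writesMem 0 = false ∧ p.writesMem 1 = false) :
    HoldsLists adj s' :=
  ⟨by rw [hf.mem 0 hp.1]; exact h.offset, by rw [hf.mem 1 hp.2]; exact h.concat⟩

theorem HoldsInput.frame {adj : Fin n → List (Fin n)} {x y : Fin n} {s' : State}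
    (h : HoldsInput adj x y s) (hf : Frame p s s')
    (hp : (p.writesMem 0 = false ∧ p.writesMem 1 = false) ∧
      p.writesReg 0 = false ∧ p.writesReg 1 = false ∧ p.writesReg 2 = false) :
    HoldsInput adj x y s' :=
  ⟨h.toHoldsLists.frame hf hp.1, by rw [hf.reg 0 hp.2.1, h.reg_zero],
    by rw [hf.reg 1 hp.2.2.1, h.reg_one], by rw [hf.reg 2 hp.2.2.2, h.reg_two]⟩

theorem sum_linear (adj : Fin n → List (Fin n)) (K : ℕ) :
    ∑ v, (K * (adj v).length + K) + 3 * n + 2 ≤ (K + 3) * (n + ∑ u, (adj u).length) + 2 := by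
  rw [Finset.sum_add_distrib, ← Finset.mul_sum]
  simp only [Finset.sum_const, Finset.card_univ, Fintype.card_fin, smul_eq_mul]
  -- The explicit slack turns the inequality into a ring identity.
  exact Nat.le.intro (k := 3 * ∑ u, (adj u).length) (by ring)

/-- The loop over all vertices. -/
def vertLoop (p : Program) : Program := forLoop 6 0 p

theorem runs_vertLoop {adj : Fin n → List (Fin n)} {x y : Fin n} (hs : HoldsInput adj x y s)
    (hp6 : p.writesReg 6 = false) (hp0 : p.writesReg 0 = false) (hW : n < W)
    (I : ℕ → State → Prop) (K : ℕ) (h0 : I 0 (s.setReg 6 0))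
    (hstep : ∀ v : Fin n, ∀ s', Frame (vertLoop p) s s' → s'.reg 6 = v → I v s' →
      Runs W p s' (K * (adj v).length + K) fun s'' => I (v + 1) ((s''.setReg 4 1).setReg 6 (v + 1))) :
    Runs W (vertLoop p) s ((K + 3) * (n + ∑ u, (adj u).length) + 2)
      fun s' => I n s' ∧ Frame (vertLoop p) s s' :=
  (runs_forLoop (by decide) (by decide) (by decide) hp6 hp0 hW hs.reg_zero I
    (fun v => K * (adj v).length + K) h0 hstep).mono (sum_linear adj K) fun _ h => h

theorem runs_vertMap {adj : Fin n → List (Fin n)} {x y : Fin n} (hs : HoldsInput adj x y s)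
    (hp6 : p.writesReg 6 = false) (hp0 : p.writesReg 0 = false) (hW : n < W)
    (arr : ℕ) (F : Fin n → ℕ) (K : ℕ)
    (hstep : ∀ v : Fin n, ∀ s', Frame (vertLoop p) s s' → s'.reg 6 = v →
      Runs W p s' (K * (adj v).length + K)
        fun s'' => s''.mem arr = Function.update (s'.mem arr) v (F v)) :
    Runs W (vertLoop p) s ((K + 3) * (n + ∑ u, (adj u).length) + 2)
      fun s' => (∀ v : Fin n, s'.mem arr v = F v) ∧ Frame (vertLoop p) s s' :=
  (runs_map (by decide) (by decide) (by decide) hp6 hp0 hW hs.reg_zero arr F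
    (fun v => K * (adj v).length + K) hstep).mono (sum_linear adj K) fun _ h => h

/-- Store into array `z + 1` whether `v` is near the vertex in register `z`. -/
def nearLoop (z : ℕ) : Program :=
  vertLoop (
    (.const 13 0 ;; .ite (.eq 6 z) (.const 13 1) .skip) ;;
    adjLoop 6 7 8 9 (.ite (.eq 9 z) (.const 13 1) .skip) ;;
    .store (z + 1) 6 13)

variable {G : SimpleGraph (Fin n)} {x y : Fin n} {adj : Fin n → List (Fin n)}

theorem runs_nearLoop (hG : IsAdjacencyLists G adj) (hs : HoldsInput adj x y s)
    (hW : n + ∑ u, (adj u).length + 5 < W) {z : ℕ} {c : Fin n} (hz : z = 1 ∨ z = 2)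
    (hc : s.reg z = c) :
    Runs W (nearLoop z) s (20 * (n + ∑ u, (adj u).length) + 2) fun s' =>
      (∀ v : Fin n, s'.mem (z + 1) v = ind (G.Near c v)) ∧ Frame (nearLoop z) s s' := by
  have hz' : z ≠ 13 ∧ z ≠ 6 ∧ z ≠ 4 ∧ z ≠ 7 ∧ z ≠ 8 ∧ z ≠ 9 := by omega
  have hpz : (nearLoop z).writesReg z = false := by rcases hz with rfl | rfl <;> rfl
  have hm : (nearLoop z).writesMem 0 = false ∧ (nearLoop z).writesMem 1 = false := by
    rcases hz with rfl | rfl <;> exact ⟨rfl, rfl⟩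
  refine (runs_vertMap hs rfl rfl (by omega) (z + 1) (fun v => ind (G.Near c v)) 17 ?_).mono
    (by omega) fun _ h => h
  intro v s' hf hv
  have hcz : s'.reg z = c := (hf.reg z hpz).trans hc
  refine (Runs.cut (T := 4) (T' := (3 + 4) * (adj v).length + 5 + 1)
    (R := fun t => t.reg 13 = ind (v = c))
    (runs_of_wp ?_) fun s₁ hf₁ h₁ => ?_).mono (by omega) fun _ h => h
  · simp only [Program.wp, Test.Holds, State.setReg_reg, if_true, hz'.1, if_false, hv, hcz,
      Nat.reduceEqDiff, Fin.val_inj]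
    exact ⟨by omega, fun h => ⟨by omega, (ind_true h).symm⟩, fun h => (ind_false h).symm⟩
  have hv₁ : s₁.reg 6 = v := (hf₁.reg 6 rfl).trans hv
  have hcz₁ : s₁.reg z = c := (hf₁.reg z (by simp [Program.writesReg, hz'])).trans hcz
  refine Runs.cut (runs_adjLoop (p := .ite (.eq 9 z) (.const 13 1) .skip) v hv₁
    ((hs.toHoldsLists.frame hf hm).frame hf₁ ⟨rfl, rfl⟩) (by decide) ⟨rfl, rfl, rfl⟩
    (by omega) (fun l t => t.reg 13 = ind (v = c ∨ c ∈ l)) 3 ?_ ?_ ?_) ?_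
  · rintro l t r k hr hl
    have : r ≠ 13 := by omega
    simpa [this.symm] using hl
  · simpa using h₁
  · intro l w l' hl t hft hw hI
    have hct : t.reg z = c :=
      (hft.reg z (by simp [adjLoop, incr, Program.writesReg, hz'])).trans hcz₁
    refine runs_of_wp (p := .ite (.eq 9 z) (.const 13 1) .skip) ?_
    simp only [Program.wp, Test.Holds, hw, hct, State.setReg_reg, if_true, hI, Fin.val_inj]
    refine ⟨fun h => ⟨by omega, ?_⟩, fun h => ?_⟩
    · rw [ind_true]; simp [h]
    · refine ind_congr ?_
      simp [Ne.symm h]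
  · rintro s₂ hf₂ ⟨hI, -⟩
    refine runs_of_wp (p := .store (z + 1) 6 13) ?_
    have hm₁ : s₂.mem (z + 1) = s'.mem (z + 1) :=
      (hf₂.mem (z + 1) rfl).trans (hf₁.mem (z + 1) rfl)
    simp only [Program.wp, State.setMem_mem, if_true, hm₁, (hf₂.reg 6 rfl).trans hv₁, hI]
    congr 1
    refine ind_congr ?_
    rw [hG.mem_iff]
    rfl

/-- Store into array `4` whether `v` is a candidate. -/
def candLoop : Program :=
  vertLoop (
    .const 13 0 ;;
    adjLoop 6 7 8 9 (.load 14 2 9 ;; .load 15 3 9 ;; .ite (.ne 14 15) (.const 13 1) .skip) ;;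
    (.load 14 2 6 ;; .load 15 3 6 ;; .const 4 1 ;;
      .ite (.eq 14 4) (.const 13 0) .skip ;; .ite (.eq 15 4) (.const 13 0) .skip ;;
      .store 4 6 13))

theorem runs_candLoop (hG : IsAdjacencyLists G adj) (hs : HoldsInput adj x y s)
    (hW : n + ∑ u, (adj u).length + 5 < W)
    (h2 : ∀ v : Fin n, s.mem 2 v = ind (G.Near x v))
    (h3 : ∀ v : Fin n, s.mem 3 v = ind (G.Near y v)) :
    Runs W candLoop s (30 * (n + ∑ u, (adj u).length) + 2) fun s' =>
      (∀ v : Fin n, s'.mem 4 v = ind (G.Cand x y v)) ∧ Frame candLoop s s' := by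
  refine (runs_vertMap hs rfl rfl (by omega) 4 (fun v => ind (G.Cand x y v)) 20 ?_).mono
    (by omega) fun _ h => h
  intro v s' hf hv
  refine (Runs.cut (T := 1) (T' := (5 + 4) * (adj v).length + 5 + 10)
    (R := fun t => t.reg 13 = 0)
    (runs_of_wp (p := .const 13 0) ?_) fun s₁ hf₁ h₁ => ?_).mono (by omega) fun _ h => h
  · simp only [Program.wp, State.setReg_reg, if_true, and_true]
    omega
  have hv₁ : s₁.reg 6 = v := (hf₁.reg 6 rfl).trans hv
  refine Runs.cut (runs_adjLoop v hv₁
    ((hs.toHoldsLists.frame hf ⟨rfl, rfl⟩).frame hf₁ ⟨rfl, rfl⟩) (by decide) ⟨rfl, rfl, rfl⟩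
    (by omega) (fun l t => t.reg 13 = ind (∃ a ∈ l, G.Priv x y a)) 5 ?_ ?_ ?_) ?_
  · rintro l t r k hr hl
    have : r ≠ 13 := by omega
    simpa [this.symm] using hl
  · simpa [ind] using h₁
  · intro l w l' hl t hft hw hI
    refine runs_of_wp (p := .load 14 2 9 ;; .load 15 3 9 ;; .ite (.ne 14 15) (.const 13 1) .skip) ?_
    have e2 : t.mem 2 w = ind (G.Near x w) := by
      rw [hft.mem 2 rfl, hf₁.mem 2 rfl, hf.mem 2 rfl, h2]
    have e3 : t.mem 3 w = ind (G.Near y w) := by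
      rw [hft.mem 3 rfl, hf₁.mem 3 rfl, hf.mem 3 rfl, h3]
    simp only [Program.wp, Test.Holds, hw, State.setReg_reg, State.setReg_mem, if_true, hI,
      Nat.reduceEqDiff, if_false, e2, e3, ne_eq]
    refine ⟨fun h => ⟨by omega, ?_⟩, fun h => ind_congr ?_⟩
    · rw [ind_true]
      exact ⟨w, by simp, fun h' => h (ind_congr h')⟩
    · have : ¬G.Priv x y w := fun h' => h' (ind_inj.1 (not_not.1 h))
      simp [or_and_right, exists_or, this]
  · rintro s₂ hf₂ ⟨hI, -⟩
    refine runs_of_wp (p := .load 14 2 6 ;; .load 15 3 6 ;; .const 4 1 ;;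
      .ite (.eq 14 4) (.const 13 0) .skip ;; .ite (.eq 15 4) (.const 13 0) .skip ;;
      .store 4 6 13) ?_
    have e2 : s₂.mem 2 v = ind (G.Near x v) := by
      rw [hf₂.mem 2 rfl, hf₁.mem 2 rfl, hf.mem 2 rfl, h2]
    have e3 : s₂.mem 3 v = ind (G.Near y v) := by
      rw [hf₂.mem 3 rfl, hf₁.mem 3 rfl, hf.mem 3 rfl, h3]
    have e4 : s₂.mem 4 = s'.mem 4 := (hf₂.mem 4 rfl).trans (hf₁.mem 4 rfl)
    have hv₂ : s₂.reg 6 = v := (hf₂.reg 6 rfl).trans hv₁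
    simp only [Program.wp, Test.Holds, State.setReg_reg, State.setReg_mem, if_true, hI,
      Nat.reduceEqDiff, if_false, e2, e3, e4, hv₂, ind_eq_one, State.setMem_mem, hG.mem_iff]
    have h1W : 1 < W := by omega
    have h0W : 0 < W := by omega
    by_cases hx : G.Near x v <;> by_cases hy : G.Near y v <;>
      simp [hx, hy, h1W, h0W, Cand, ind_false]

end RAM

/-! ### Computing partners, needy vertices and mutual pairs. -/

namespace RAM

open SimpleGraph

variable {W : ℕ} {s : State} {n : ℕ} {G : SimpleGraph (Fin n)} {x y : Fin n}
  {adj : Fin n → List (Fin n)}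

open Classical in
/-- The last element with a given property of an adjacency list. -/
noncomputable def lastWith (P : Fin n → Prop) (l : List (Fin n)) : Option (Fin n) :=
  (l.filter fun w => P w).getLast?

theorem isPartner_lastWith (hG : IsAdjacencyLists G adj) :
    G.IsPartner x y fun d => lastWith (G.Cand x y) (adj d) := by
  classical
  constructor
  · intro d hd e hde hC
    simp only [lastWith, List.getLast?_eq_none_iff, List.filter_eq_nil_iff] at hd
    exact hd e ((hG.mem_iff d e).2 hde) (by simpa using hC)
  · intro d e hde
    have := List.mem_of_getLast? hde
    rw [List.mem_filter, hG.mem_iff] at this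
    exact ⟨this.1, by simpa using this.2⟩

/-- A left-to-right scan that overwrites a register ends with the last match, hence the choice of
the last element. -/
theorem lastWith_append (P : Fin n → Prop) (l : List (Fin n)) (w : Fin n) [Decidable (P w)] :
    lastWith P (l ++ [w]) = if P w then some w else lastWith P l := by
  classical
  by_cases h : P w <;> simp [lastWith, List.filter_append, h]

/-- Store into array `5` the partner of `v`. -/
def partnerLoop : Program :=
  vertLoop (
    .const 13 0 ;;
    adjLoop 6 7 8 9 (.load 14 4 9 ;; .const 4 1 ;; .ite (.eq 14 4) (.add 13 9 4) .skip) ;;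
    .store 5 6 13)

theorem runs_partnerLoop (hs : HoldsInput adj x y s)
    (hW : n + ∑ u, (adj u).length + 5 < W)
    (h4 : ∀ v : Fin n, s.mem 4 v = ind (G.Cand x y v)) :
    Runs W partnerLoop s (20 * (n + ∑ u, (adj u).length) + 2) fun s' =>
      (∀ v : Fin n, s'.mem 5 v = enc (lastWith (G.Cand x y) (adj v))) ∧
        Frame partnerLoop s s' := by
  classical
  refine (runs_vertMap hs rfl rfl (by omega) 5
    (fun v => enc (lastWith (G.Cand x y) (adj v))) 17 ?_).mono (by omega) fun _ h => h
  intro v s' hf hv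
  refine (Runs.cut (T := 1) (T' := (5 + 4) * (adj v).length + 5 + 1)
    (R := fun t => t.reg 13 = 0)
    (runs_of_wp (p := .const 13 0) ?_) fun s₁ hf₁ h₁ => ?_).mono (by omega) fun _ h => h
  · simp only [Program.wp, State.setReg_reg, if_true, and_true]
    omega
  have hv₁ : s₁.reg 6 = v := (hf₁.reg 6 rfl).trans hv
  refine Runs.cut (runs_adjLoop v hv₁
    ((hs.toHoldsLists.frame hf ⟨rfl, rfl⟩).frame hf₁ ⟨rfl, rfl⟩) (by decide) ⟨rfl, rfl, rfl⟩
    (by omega) (fun l t => t.reg 13 = enc (lastWith (G.Cand x y) l)) 5 ?_ ?_ ?_) ?_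
  · rintro l t r k hr hl
    have : r ≠ 13 := by omega
    simpa [this.symm] using hl
  · simpa [lastWith, enc] using h₁
  · intro l w l' hl t hft hw hI
    refine runs_of_wp (p := .load 14 4 9 ;; .const 4 1 ;; .ite (.eq 14 4) (.add 13 9 4) .skip) ?_
    have e4 : t.mem 4 w = ind (G.Cand x y w) := by
      rw [hft.mem 4 rfl, hf₁.mem 4 rfl, hf.mem 4 rfl, h4]
    simp only [Program.wp, Test.Holds, hw, State.setReg_reg, if_true, hI,
      Nat.reduceEqDiff, if_false, e4, ind_eq_one, lastWith_append]
    refine ⟨by omega, fun h => ⟨by omega, ?_⟩, fun h => ?_⟩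
    · rw [if_pos h]; rfl
    · rw [if_neg h]
  · rintro s₂ hf₂ ⟨hI, -⟩
    refine runs_of_wp (p := .store 5 6 13) ?_
    simp only [Program.wp, State.setMem_mem, if_true, (hf₂.reg 6 rfl).trans hv₁, hI,
      (hf₂.mem 5 rfl).trans (hf₁.mem 5 rfl)]

/-- Store into array `6` whether `v` is needy. -/
def needyLoop : Program :=
  vertLoop (
    (.load 14 2 6 ;; .load 15 3 6 ;; .const 13 0 ;; .ite (.ne 14 15) (.const 13 1) .skip) ;;
    adjLoop 6 7 8 9 (
      (.load 15 5 9 ;; .const 16 0) ;;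
      adjLoop 6 10 11 12 (.const 4 1 ;; .add 17 12 4 ;; .ite (.eq 17 15) (.const 16 1) .skip) ;;
      (.load 14 4 9 ;; .const 4 1 ;; .ite (.eq 14 4)
        (.ite (.eq 16 4) (.const 13 0) (.const 4 0 ;; .ite (.eq 15 4) (.const 13 0) .skip))
        .skip)) ;;
    .store 6 6 13)

theorem runs_needyLoop (hG : IsAdjacencyLists G adj) (hs : HoldsInput adj x y s)
    (hW : n + ∑ u, (adj u).length + 5 < W) {pt : Fin n → Option (Fin n)}
    (h2 : ∀ v : Fin n, s.mem 2 v = ind (G.Near x v))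
    (h3 : ∀ v : Fin n, s.mem 3 v = ind (G.Near y v))
    (h4 : ∀ v : Fin n, s.mem 4 v = ind (G.Cand x y v))
    (h5 : ∀ v : Fin n, s.mem 5 v = enc (pt v)) :
    Runs W needyLoop s ((30 * n + 33) * (n + ∑ u, (adj u).length) + 2) fun s' =>
      (∀ v : Fin n, s'.mem 6 v = ind (G.Needy x y pt v)) ∧ Frame needyLoop s s' := by
  refine (runs_vertMap hs rfl rfl (by omega) 6
    (fun v => ind (G.Needy x y pt v)) (30 * n + 30) ?_).mono (by ring_nf; omega) fun _ h => h
  intro v s' hf hv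
  -- The list of `v` is scanned once for each of its elements; one factor of the squared degree is
  -- bounded by `n`, so the per-edge constant may depend on `n`.
  have hlen : (adj v).length ≤ n := (hG.nodup v).length_le_card.trans (by simp)
  refine (Runs.cut (T := 6) (T' := (9 * n + 25 + 4) * (adj v).length + 5 + 1)
    (R := fun t => t.reg 13 = ind (G.Priv x y v))
    (runs_of_wp (p := .load 14 2 6 ;; .load 15 3 6 ;; .const 13 0 ;;
      .ite (.ne 14 15) (.const 13 1) .skip) ?_) fun s₁ hf₁ h₁ => ?_).mono
    (Nat.le.intro (k := (21 * n + 1) * (adj v).length + 30 * n + 18) (by ring)) fun _ h => h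
  · have e2 : s'.mem 2 v = ind (G.Near x v) := by rw [hf.mem 2 rfl, h2]
    have e3 : s'.mem 3 v = ind (G.Near y v) := by rw [hf.mem 3 rfl, h3]
    simp only [Program.wp, Test.Holds, State.setReg_reg, State.setReg_mem, if_true, hv,
      Nat.reduceEqDiff, if_false, e2, e3, ne_eq]
    refine ⟨by omega, fun h => ⟨by omega, (ind_true fun h' => h (ind_congr h')).symm⟩,
      fun h => (ind_false fun h' => h' (ind_inj.1 (not_not.1 h))).symm⟩
  have hv₁ : s₁.reg 6 = v := (hf₁.reg 6 rfl).trans hv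
  have hL₁ := (hs.toHoldsLists.frame hf ⟨rfl, rfl⟩).frame hf₁ ⟨rfl, rfl⟩
  refine Runs.cut (runs_adjLoop v hv₁ hL₁ (by decide) ⟨rfl, rfl, rfl⟩
    (by omega) (fun l t => t.reg 13 = ind (G.Priv x y v ∧ ∀ d ∈ l, G.Cand x y d →
      ∃ e, pt d = some e ∧ ¬G.Adj v e)) (9 * n + 25) ?_ ?_ ?_) ?_
  · rintro l t r k hr hl
    have : r ≠ 13 := by omega
    simpa [this.symm] using hl
  · simpa using h₁
  · intro l d l' hl t hft hw hI
    refine (Runs.cut (T := 2) (T' := (5 + 4) * (adj v).length + 5 + 10)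
      (R := fun t' => t'.reg 15 = enc (pt d) ∧ t'.reg 16 = 0)
      (runs_of_wp (p := .load 15 5 9 ;; .const 16 0) ?_) fun t₁ hft₁ h₁ => ?_).mono
      (by omega) fun _ h => h
    · have e5 : t.mem 5 d = enc (pt d) := by
        rw [hft.mem 5 rfl, hf₁.mem 5 rfl, hf.mem 5 rfl, h5]
      simp [Program.wp, hw, e5]
      omega
    have hv₂ : t₁.reg 6 = v := ((hft₁.reg 6 rfl).trans (hft.reg 6 rfl)).trans hv₁
    refine Runs.cut (runs_adjLoop v hv₂
      ((hL₁.frame hft ⟨rfl, rfl⟩).frame hft₁ ⟨rfl, rfl⟩) (by decide) ⟨rfl, rfl, rfl⟩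
      (by omega) (fun l t => t.reg 16 = ind (∃ e ∈ l, pt d = some e)) 5 ?_ ?_ ?_) ?_
    · rintro l t r k hr hl
      have : r ≠ 16 := by omega
      simpa [this.symm] using hl
    · simpa [ind_false] using h₁.2
    · intro m e m' hm u hfu hwu hIu
      refine runs_of_wp (p := .const 4 1 ;; .add 17 12 4 ;;
        .ite (.eq 17 15) (.const 16 1) .skip) ?_
      have e15 : u.reg 15 = enc (pt d) := (hfu.reg 15 rfl).trans h₁.1
      have hen : e.val < n := e.2
      simp only [Program.wp, Test.Holds, State.setReg_reg, if_true, hwu, hIu,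
        Nat.reduceEqDiff, if_false, e15]
      refine ⟨by omega, by omega, fun h => ⟨by omega, ?_⟩, fun h => ind_congr ?_⟩
      · rw [ind_true]
        refine ⟨e, by simp, ?_⟩
        rcases hpt : pt d with _ | f
        · simp [hpt, enc] at h
        · simp only [hpt, enc, Nat.add_right_cancel_iff, Fin.val_inj] at h
          rw [h]
      · have : pt d ≠ some e := by
          rintro h'
          rw [h'] at h
          exact h rfl
        simp [or_and_right, exists_or, this]
    · rintro t₂ hft₂ ⟨hI₂, -⟩
      refine runs_of_wp (p := .load 14 4 9 ;; .const 4 1 ;; .ite (.eq 14 4)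
        (.ite (.eq 16 4) (.const 13 0) (.const 4 0 ;; .ite (.eq 15 4) (.const 13 0) .skip))
        .skip) ?_
      have hw₂ : t₂.reg 9 = d := ((hft₂.reg 9 rfl).trans (hft₁.reg 9 rfl)).trans hw
      have e4 : t₂.mem 4 d = ind (G.Cand x y d) := by
        rw [hft₂.mem 4 rfl, hft₁.mem 4 rfl, hft.mem 4 rfl, hf₁.mem 4 rfl, hf.mem 4 rfl, h4]
      have e15 : t₂.reg 15 = enc (pt d) := (hft₂.reg 15 rfl).trans h₁.1
      have e13 : t₂.reg 13 = ind (G.Priv x y v ∧ ∀ d ∈ l, G.Cand x y d →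
          ∃ e, pt d = some e ∧ ¬G.Adj v e) :=
        ((hft₂.reg 13 rfl).trans (hft₁.reg 13 rfl)).trans hI
      simp only [Program.wp, Test.Holds, State.setReg_reg, if_true, hw₂, hI₂,
        Nat.reduceEqDiff, if_false, e15, e4, e13, ind_eq_one, hG.mem_iff]
      refine ⟨by omega, fun hC => ⟨fun h => ⟨by omega, ?_⟩, fun h => ⟨by omega, fun h0 =>
        ⟨by omega, ?_⟩, fun h0 => ?_⟩⟩, fun hC => ?_⟩
      · rw [ind_false]
        rintro ⟨-, h'⟩
        obtain ⟨e, he, hpe⟩ := h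
        obtain ⟨f, hf, hvf⟩ := h' d (by simp) hC
        rw [hpe] at hf
        exact hvf (Option.some.inj hf ▸ he)
      · rw [ind_false]
        rintro ⟨-, h'⟩
        obtain ⟨f, hf, hvf⟩ := h' d (by simp) hC
        rw [hf] at h0
        exact absurd h0 (by simp [enc])
      · refine ind_congr (and_congr_right fun _ => ?_)
        have hd : ∃ e, pt d = some e ∧ ¬G.Adj v e := by
          rcases hpt : pt d with _ | f
          · simp [hpt, enc] at h0
          · exact ⟨f, rfl, fun hvf => h ⟨f, hvf, hpt⟩⟩
        simp [or_imp, forall_and, hd]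
      · refine ind_congr (and_congr_right fun _ => ?_)
        simp [or_imp, forall_and, hC]
  · rintro s₂ hf₂ ⟨hI, -⟩
    refine runs_of_wp (p := .store 6 6 13) ?_
    simp only [Program.wp, State.setMem_mem, if_true, (hf₂.reg 6 rfl).trans hv₁, hI,
      (hf₂.mem 6 rfl).trans (hf₁.mem 6 rfl)]
    congr 1
    refine ind_congr (and_congr_right fun _ => ?_)
    simp only [hG.mem_iff]
    exact ⟨fun h d hd hvd => h d hvd hd, fun h d hvd hd => h d hd hvd⟩

/-- Store into array `7` whether `v` is the partner of its partner. -/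
def mutualLoop : Program :=
  vertLoop (
    .const 13 0 ;; .load 14 4 6 ;; .const 4 1 ;; .ite (.eq 14 4)
      (.load 15 5 6 ;; .const 4 0 ;; .ite (.ne 15 4)
        (.const 4 1 ;; .sub 15 15 4 ;; .load 15 5 15 ;; .add 16 6 4 ;;
          .ite (.eq 15 16) (.const 13 1) .skip) .skip) .skip ;;
    .store 7 6 13)

theorem runs_mutualLoop (hs : HoldsInput adj x y s)
    (hW : n + ∑ u, (adj u).length + 5 < W) {pt : Fin n → Option (Fin n)}
    (h4 : ∀ v : Fin n, s.mem 4 v = ind (G.Cand x y v))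
    (h5 : ∀ v : Fin n, s.mem 5 v = enc (pt v)) :
    Runs W mutualLoop s (30 * (n + ∑ u, (adj u).length) + 2) fun s' =>
      (∀ v : Fin n, s'.mem 7 v = ind (G.Mutual x y pt v)) ∧ Frame mutualLoop s s' := by
  refine (runs_vertMap hs rfl rfl (by omega) 7
    (fun v => ind (G.Mutual x y pt v)) 20 ?_).mono (by omega) fun _ h => h
  intro v s' hf hv
  have hvn : v.val < n := v.2
  have e4 : s'.mem 4 v = ind (G.Cand x y v) := by rw [hf.mem 4 rfl, h4]
  have e5 : ∀ v : Fin n, s'.mem 5 v = enc (pt v) := fun v => by rw [hf.mem 5 rfl, h5]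
  refine (runs_of_wp (p := .const 13 0 ;; .load 14 4 6 ;; .const 4 1 ;; .ite (.eq 14 4)
      (.load 15 5 6 ;; .const 4 0 ;; .ite (.ne 15 4)
        (.const 4 1 ;; .sub 15 15 4 ;; .load 15 5 15 ;; .add 16 6 4 ;;
          .ite (.eq 15 16) (.const 13 1) .skip) .skip) .skip ;;
    .store 7 6 13) ?_).mono (by simp only [Program.size]; omega) fun _ h => h
  simp only [Program.wp, Test.Holds, State.setReg_reg, State.setReg_mem, State.setMem_mem, if_true,
    hv, Nat.reduceEqDiff, if_false, e4, e5, ind_eq_one, ne_eq]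
  refine ⟨by omega, by omega, fun hC => ⟨by omega, fun h => ⟨by omega, ?_⟩, fun h => ?_⟩,
    fun hC => ?_⟩
  · obtain ⟨e, he⟩ : ∃ e, pt v = some e := by
      rcases hpt : pt v with _ | e
      · simp [hpt, enc] at h
      · exact ⟨e, rfl⟩
    simp only [he, enc, Nat.add_sub_cancel, e5]
    refine ⟨by omega, fun h => ⟨by omega, ?_⟩, fun h => ?_⟩
    · rw [ind_true]
      refine ⟨hC, e, he, ?_⟩
      rcases hpt : pt e with _ | f
      · simp [hpt] at h
      · simp only [hpt, Nat.add_right_cancel_iff, Fin.val_inj] at h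
        rw [h]
    · rw [ind_false]
      rintro ⟨-, f, hf, hfe⟩
      rw [he, Option.some.injEq] at hf
      rw [hf, hfe] at h
      exact h rfl
  · rw [ind_false]
    rintro ⟨-, f, hf, -⟩
    rw [hf] at h
    exact h (by simp [enc])
  · rw [ind_false]
    exact fun h => hC h.1

end RAM

/-! ## The program: forced choices -/

namespace RAM

open SimpleGraph

noncomputable instance {V : Type*} (G : SimpleGraph V) (x y a : V) :
    DecidablePred (G.Hits x y a) := fun _ => Classical.propDecidable _

variable {W : ℕ} {s : State} {n : ℕ} {G : SimpleGraph (Fin n)} {x y : Fin n}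
  {adj : Fin n → List (Fin n)}

theorem countP_adj (hG : IsAdjacencyLists G adj) (v : Fin n) (S : Finset (Fin n)) (P : Fin n → Prop)
    [DecidablePred P] (hS : ∀ w, w ∈ S ↔ G.Adj v w ∧ P w) : (adj v).countP (fun w => P w) = S.card := by
  rw [List.countP_eq_length_filter, ← List.toFinset_card_of_nodup ((hG.nodup v).filter _)]
  congr 1
  ext w
  simp [hS, hG.mem_iff]

/-- Store into array `8` the number of neighbours that are marked in array `6`. -/
def degLoop : Program :=
  vertLoop (
    .const 13 0 ;; adjLoop 6 7 8 9 (.load 14 6 9 ;; .add 13 13 14) ;; .store 8 6 13)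

theorem runs_degLoop (hG : IsAdjacencyLists G adj) (hs : HoldsInput adj x y s)
    (hW : n + ∑ u, (adj u).length + 5 < W) {A : Finset (Fin n)}
    (h6 : ∀ v : Fin n, s.mem 6 v = ind (v ∈ A)) :
    Runs W degLoop s (20 * (n + ∑ u, (adj u).length) + 2) fun s' =>
      (∀ v : Fin n, s'.mem 8 v = (adj v).countP (· ∈ A)) ∧ Frame degLoop s s' := by
  refine (runs_vertMap hs rfl rfl (by omega) 8
    (fun v => (adj v).countP (· ∈ A)) 17 ?_).mono (by omega) fun _ h => h
  intro v s' hf hv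
  have hlen : (adj v).length ≤ n := (hG.nodup v).length_le_card.trans (by simp)
  refine (Runs.cut (T := 1) (T' := (2 + 4) * (adj v).length + 5 + 1)
    (R := fun t => t.reg 13 = 0)
    (runs_of_wp (p := .const 13 0) ?_) fun s₁ hf₁ h₁ => ?_).mono (by omega) fun _ h => h
  · simp only [Program.wp, State.setReg_reg, if_true, and_true]
    omega
  have hv₁ : s₁.reg 6 = v := (hf₁.reg 6 rfl).trans hv
  refine Runs.cut (runs_adjLoop v hv₁
    ((hs.toHoldsLists.frame hf ⟨rfl, rfl⟩).frame hf₁ ⟨rfl, rfl⟩) (by decide) ⟨rfl, rfl, rfl⟩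
    (by omega) (fun l t => t.reg 13 = l.countP (· ∈ A)) 2 ?_ ?_ ?_) ?_
  · rintro l t r k hr hl
    have : r ≠ 13 := by omega
    simpa [this.symm] using hl
  · simpa using h₁
  · intro l w l' hl t hft hw hI
    refine runs_of_wp (p := .load 14 6 9 ;; .add 13 13 14) ?_
    have e6 : t.mem 6 w = ind (w ∈ A) := by
      rw [hft.mem 6 rfl, hf₁.mem 6 rfl, hf.mem 6 rfl, h6]
    have h1 := ind_le_one (w ∈ A)
    have h2 : l.countP (· ∈ A) ≤ l.length := List.countP_le_length
    have h3 : l.length ≤ (adj v).length := by simp [hl]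
    simp only [Program.wp, hw, State.setReg_reg, if_true, hI,
      Nat.reduceEqDiff, if_false, e6]
    refine ⟨by omega, ?_⟩
    by_cases h : w ∈ A <;> simp [h, ind_true, ind_false]
  · rintro s₂ hf₂ ⟨hI, -⟩
    refine runs_of_wp (p := .store 8 6 13) ?_
    simp only [Program.wp, State.setMem_mem, if_true, (hf₂.reg 6 rfl).trans hv₁, hI,
      (hf₂.mem 8 rfl).trans (hf₁.mem 8 rfl)]

/-- The choice of a literal of the clause `a` is forced. -/
def IsTight (G : SimpleGraph (Fin n)) (x y : Fin n) (A L : Finset (Fin n)) (a : Fin n) : Prop :=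
  (lits (G.Hits x y) L a).card = 1 ∨
    (lits (G.Hits x y) L a).card = 2 ∧ (bigLits (G.Hits x y) A L a).card = 1

/-- The literal `q` is the forced choice for a clause. -/
def IsForced (G : SimpleGraph (Fin n)) (x y : Fin n) (A L : Finset (Fin n)) (q : Fin n) : Prop :=
  ∃ a ∈ A, ((lits (G.Hits x y) L a).card = 1 ∧ q ∈ lits (G.Hits x y) L a) ∨
    ((lits (G.Hits x y) L a).card = 2 ∧ (bigLits (G.Hits x y) A L a).card = 1 ∧
      q ∈ bigLits (G.Hits x y) A L a)

/-- Set register `20` to `q + 1` for a forced choice `q`, if there is one, and set register `21` to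
`1` if there is a clause without a literal. -/
def findLoop : Program :=
  vertLoop (
    (.const 13 0 ;; .const 14 0) ;;
    adjLoop 6 7 8 9 (
      .load 17 7 9 ;; .const 4 1 ;; .ite (.eq 17 4)
        (.add 13 13 4 ;; .copy 15 9 ;; .load 18 8 9 ;;
          .ite (.lt 4 18) (.add 14 14 4 ;; .copy 16 9) .skip) .skip) ;;
    (.load 17 6 6 ;; .const 4 1 ;; .ite (.eq 17 4)
      (.ite (.eq 13 4) (.add 20 15 4)
          (.ite (.eq 14 4) (.const 4 2 ;; .ite (.eq 13 4) (.const 4 1 ;; .add 20 16 4) .skip)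
            .skip) ;;
        .const 4 0 ;; .ite (.eq 13 4) (.const 21 1) .skip) .skip))

/-- Later clauses may overwrite register `20`, so only the forcedness of the final value is
asserted. The failure flag in register `21` is never cleared. -/
theorem runs_findLoop (hG : IsAdjacencyLists G adj) (hs : HoldsInput adj x y s)
    (hW : n + ∑ u, (adj u).length + 5 < W) {A L : Finset (Fin n)} (hA : ∀ a ∈ A, G.Priv x y a)
    (h6 : ∀ v : Fin n, s.mem 6 v = ind (v ∈ A)) (h7 : ∀ v : Fin n, s.mem 7 v = ind (v ∈ L))
    (h8 : ∀ v : Fin n, s.mem 8 v = (adj v).countP (· ∈ A)) (h20 : s.reg 20 = 0) :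
    Runs W findLoop s (40 * (n + ∑ u, (adj u).length) + 2) fun s' =>
      (((∃ q : Fin n, s'.reg 20 = q + 1 ∧ IsForced G x y A L q) ∨
          s'.reg 20 = 0 ∧ ∀ v ∈ A, ¬IsTight G x y A L v) ∧
        ((s'.reg 21 = 1 ∧ ∃ a ∈ A, (lits (G.Hits x y) L a).card = 0) ∨
          s'.reg 21 = s.reg 21 ∧ ∀ v ∈ A, (lits (G.Hits x y) L v).card ≠ 0)) ∧
        Frame findLoop s s' := by
  have hn : ∀ v : Fin n, v.val < n := fun v => v.2
  -- All clauses are private, so the marked neighbours of `d` are exactly the clauses containing the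
  -- literal `d`.
  have hdeg : ∀ d, (adj d).countP (· ∈ A) = (A.filter (G.Hits x y · d)).card := fun d =>
    countP_adj hG d _ (· ∈ A) fun w => by
      rw [Finset.mem_filter]
      exact ⟨fun h => ⟨h.2.2.symm, h.1⟩, fun h => ⟨h.2, hA w h.2, h.1.symm⟩⟩
  refine (runs_vertLoop hs rfl rfl (by omega) (fun k s' =>
      ((∃ q : Fin n, s'.reg 20 = q + 1 ∧ IsForced G x y A L q) ∨
          s'.reg 20 = 0 ∧ ∀ v ∈ A, v.val < k → ¬IsTight G x y A L v) ∧
        ((s'.reg 21 = 1 ∧ ∃ a ∈ A, (lits (G.Hits x y) L a).card = 0) ∨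
          s'.reg 21 = s.reg 21 ∧ ∀ v ∈ A, v.val < k → (lits (G.Hits x y) L v).card ≠ 0)) 30
      ?_ ?_).mono (by omega) ?_
  · simp [h20]
  · intro v s' hf hv hI
    have hlen : (adj v).length ≤ n := (hG.nodup v).length_le_card.trans (by simp)
    refine (Runs.cut (T := 2) (T' := (11 + 4) * (adj v).length + 5 + 17)
      (R := fun t => t.reg 13 = 0 ∧ t.reg 14 = 0)
      (runs_of_wp (p := .const 13 0 ;; .const 14 0) ?_) fun s₁ hf₁ h₁ => ?_).mono
      (by omega) fun _ h => h
    · simp [Program.wp]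
      omega
    have hv₁ : s₁.reg 6 = v := (hf₁.reg 6 rfl).trans hv
    refine Runs.cut (runs_adjLoop v hv₁
      ((hs.toHoldsLists.frame hf ⟨rfl, rfl⟩).frame hf₁ ⟨rfl, rfl⟩) (by decide) ⟨rfl, rfl, rfl⟩
      -- Registers `15` and `16` are not reset between vertices, so they are meaningful only when
      -- the corresponding counter is nonzero.
      (by omega) (fun l t => t.reg 13 = l.countP (· ∈ L) ∧
        t.reg 14 = l.countP (fun d => d ∈ L ∧ 2 ≤ (adj d).countP (· ∈ A)) ∧
        (t.reg 13 ≠ 0 → ∃ d ∈ l, d ∈ L ∧ t.reg 15 = d) ∧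
        (t.reg 14 ≠ 0 → ∃ d ∈ l, (d ∈ L ∧ 2 ≤ (adj d).countP (· ∈ A)) ∧ t.reg 16 = d))
      11 ?_ ?_ ?_) ?_
    · rintro l t r k hr hl
      have h : 13 ≠ r ∧ 14 ≠ r ∧ 15 ≠ r ∧ 16 ≠ r := by
        rcases hr with rfl | rfl | rfl | rfl <;> decide
      simp only [State.setReg_reg, if_neg h.1, if_neg h.2.1, if_neg h.2.2.1, if_neg h.2.2.2]
      exact hl
    · simp [h₁]
    · intro l d l' hl t hft hw hI
      refine runs_of_wp (p := .load 17 7 9 ;; .const 4 1 ;; .ite (.eq 17 4)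
        (.add 13 13 4 ;; .copy 15 9 ;; .load 18 8 9 ;;
          .ite (.lt 4 18) (.add 14 14 4 ;; .copy 16 9) .skip) .skip) ?_
      have e7 : t.mem 7 d = ind (d ∈ L) := by
        rw [hft.mem 7 rfl, hf₁.mem 7 rfl, hf.mem 7 rfl, h7]
      have e8 : t.mem 8 d = (adj d).countP (· ∈ A) := by
        rw [hft.mem 8 rfl, hf₁.mem 8 rfl, hf.mem 8 rfl, h8]
      have h2 : l.countP (· ∈ L) ≤ l.length := List.countP_le_length
      have h2' : l.countP (fun d => d ∈ L ∧ 2 ≤ (adj d).countP (· ∈ A)) ≤ l.length :=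
        List.countP_le_length
      have h3 : l.length ≤ (adj v).length := by simp [hl]
      obtain ⟨i1, i2, i3, i4⟩ := hI
      simp only [Program.wp, Test.Holds, hw, State.setReg_reg, State.setReg_mem, if_true,
        Nat.reduceEqDiff, if_false, e7, e8, ind_eq_one]
      refine ⟨by omega, fun hL => ⟨by omega, fun hb => ⟨by omega, ?_⟩, fun hb => ?_⟩, fun hL => ?_⟩
      · have hb' : 2 ≤ (adj d).countP (· ∈ A) := hb
        refine ⟨?_, ?_, fun _ => ⟨d, by simp, hL, rfl⟩, fun _ => ⟨d, by simp, ⟨hL, hb'⟩, rfl⟩⟩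
        · simp [i1, hL]
        · simp only [i2, List.countP_append, List.countP_singleton, hL, hb', and_self,
            decide_true, if_true]
      · have hb' : ¬2 ≤ (adj d).countP (· ∈ A) := hb
        refine ⟨?_, ?_, fun _ => ⟨d, by simp, hL, rfl⟩, fun h => ?_⟩
        · simp [i1, hL]
        · simp only [i2, List.countP_append, List.countP_singleton, hb', and_false, decide_false,
            Bool.false_eq_true, if_false, add_zero]
        · obtain ⟨e, he, h'⟩ := i4 h
          exact ⟨e, by simp [he], h'⟩
      · refine ⟨?_, ?_, fun h => ?_, fun h => ?_⟩
        · simp [i1, hL]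
        · simp only [i2, List.countP_append, List.countP_singleton, hL, false_and, decide_false,
            Bool.false_eq_true, if_false, add_zero]
        · obtain ⟨e, he, h'⟩ := i3 h
          exact ⟨e, by simp [he], h'⟩
        · obtain ⟨e, he, h'⟩ := i4 h
          exact ⟨e, by simp [he], h'⟩
    · rintro s₂ hf₂ ⟨⟨i1, i2, i3, i4⟩, -⟩
      refine (runs_of_wp (p := .load 17 6 6 ;; .const 4 1 ;; .ite (.eq 17 4)
        (.ite (.eq 13 4) (.add 20 15 4)
            (.ite (.eq 14 4) (.const 4 2 ;; .ite (.eq 13 4) (.const 4 1 ;; .add 20 16 4) .skip)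
              .skip) ;;
          .const 4 0 ;; .ite (.eq 13 4) (.const 21 1) .skip) .skip) ?_).mono
          (by simp only [Program.size]; omega) fun _ h => h
      have hv₂ : s₂.reg 6 = v := (hf₂.reg 6 rfl).trans hv₁
      have e6 : s₂.mem 6 v = ind (v ∈ A) := by
        rw [hf₂.mem 6 rfl, hf₁.mem 6 rfl, hf.mem 6 rfl, h6]
      have e20 : s₂.reg 20 = s'.reg 20 := (hf₂.reg 20 rfl).trans (hf₁.reg 20 rfl)
      have e21 : s₂.reg 21 = s'.reg 21 := (hf₂.reg 21 rfl).trans (hf₁.reg 21 rfl)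
      have hW0 : 0 < W := by omega
      have hW1 : 1 < W := by omega
      have hW2 : 2 < W := by omega
      by_cases hvA : v ∈ A
      · have c1 : s₂.reg 13 = (lits (G.Hits x y) L v).card := by
          rw [i1]
          refine countP_adj hG v _ (· ∈ L) fun w => ?_
          rw [mem_lits]
          exact ⟨fun h => ⟨h.2.2, h.1⟩, fun h => ⟨h.2, hA v hvA, h.1⟩⟩
        have c2 : s₂.reg 14 = (bigLits (G.Hits x y) A L v).card := by
          rw [i2]
          refine countP_adj hG v _ (fun d => d ∈ L ∧ 2 ≤ (adj d).countP (· ∈ A)) fun w => ?_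
          rw [mem_bigLits, hdeg]
          exact ⟨fun h => ⟨h.1.2.2, h.1.1, h.2⟩, fun h => ⟨⟨h.2.1, hA v hvA, h.1⟩, h.2.2⟩⟩
        have d1 : s₂.reg 13 ≠ 0 → ∃ d, s₂.reg 15 = d.val ∧ d ∈ lits (G.Hits x y) L v := by
          intro h
          obtain ⟨d, hd, hdL, h15⟩ := i3 h
          exact ⟨d, h15, mem_lits.2 ⟨hdL, hA v hvA, (hG.mem_iff v d).1 hd⟩⟩
        have d2 : s₂.reg 14 ≠ 0 → ∃ d, s₂.reg 16 = d.val ∧ d ∈ bigLits (G.Hits x y) A L v := by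
          intro h
          obtain ⟨d, hd, ⟨hdL, hb⟩, h16⟩ := i4 h
          exact ⟨d, h16, mem_bigLits.2 ⟨⟨hdL, hA v hvA, (hG.mem_iff v d).1 hd⟩, hdeg d ▸ hb⟩⟩
        have hfail : ((s'.reg 21 = 1 ∧ ∃ a ∈ A, (lits (G.Hits x y) L a).card = 0) ∨
            s'.reg 21 = s.reg 21 ∧ ∀ w ∈ A, w.val < v → (lits (G.Hits x y) L w).card ≠ 0) →
            (lits (G.Hits x y) L v).card ≠ 0 →
            ((s'.reg 21 = 1 ∧ ∃ a ∈ A, (lits (G.Hits x y) L a).card = 0) ∨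
            s'.reg 21 = s.reg 21 ∧
              ∀ w ∈ A, w.val < v.val + 1 → (lits (G.Hits x y) L w).card ≠ 0) := by
          rintro (h | ⟨h, h'⟩) h0
          · exact Or.inl h
          · refine Or.inr ⟨h, fun w hw hwv => ?_⟩
            rcases Nat.lt_succ_iff_lt_or_eq.1 hwv with h1 | h1
            · exact h' w hw h1
            · rwa [Fin.ext h1]
        have hcand : ¬IsTight G x y A L v →
            ((∃ q : Fin n, s'.reg 20 = q + 1 ∧ IsForced G x y A L q) ∨
              s'.reg 20 = 0 ∧ ∀ w ∈ A, w.val < v.val + 1 → ¬IsTight G x y A L w) := by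
          intro h0
          rcases hI.1 with h | ⟨h, h'⟩
          · exact Or.inl h
          · refine Or.inr ⟨h, fun w hw hwv => ?_⟩
            rcases Nat.lt_succ_iff_lt_or_eq.1 hwv with h1 | h1
            · exact h' w hw h1
            · rwa [Fin.ext h1]
        simp only [Program.wp, Test.Holds, hv₂, State.setReg_reg, if_true,
          Nat.reduceEqDiff, if_false, e6, e20, e21, ind_true hvA]
        refine ⟨hW1, fun _ => ⟨fun t1 => ?_, fun t1 => ⟨fun b1 => ⟨hW2, fun t2 => ⟨hW1, ?_⟩,
          fun t2 => ?_⟩, fun b1 => ?_⟩⟩, fun h => absurd trivial h⟩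
        · obtain ⟨d, h15, hd⟩ := d1 (by omega)
          have := d.2
          refine ⟨by omega, hW0, fun h => by omega, fun h => ⟨Or.inl ⟨d, by rw [h15], v, hvA,
            Or.inl ⟨c1 ▸ t1, hd⟩⟩, hfail hI.2 (c1 ▸ h)⟩⟩
        · obtain ⟨d, h16, hd⟩ := d2 (by omega)
          have := d.2
          refine ⟨by omega, hW0, fun h => by omega, fun h => ⟨Or.inl ⟨d, by rw [h16], v, hvA,
            Or.inr ⟨c1 ▸ t2, c2 ▸ b1, hd⟩⟩, hfail hI.2 (c1 ▸ h)⟩⟩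
        · have ht : ¬IsTight G x y A L v := by
            unfold IsTight
            omega
          exact ⟨hW0, fun h => ⟨hW1, hcand ht, Or.inl ⟨trivial, v, hvA, c1 ▸ h⟩⟩,
            fun h => ⟨hcand ht, hfail hI.2 (c1 ▸ h)⟩⟩
        · have ht : ¬IsTight G x y A L v := by
            unfold IsTight
            omega
          exact ⟨hW0, fun h => ⟨hW1, hcand ht, Or.inl ⟨trivial, v, hvA, c1 ▸ h⟩⟩,
            fun h => ⟨hcand ht, hfail hI.2 (c1 ▸ h)⟩⟩
      · have hlt : ∀ w ∈ A, w.val < v.val + 1 → w.val < v := by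
          intro w hw hwv
          rcases Nat.lt_succ_iff_lt_or_eq.1 hwv with h1 | h1
          · exact h1
          · exact absurd (Fin.ext h1 ▸ hw) hvA
        simp only [Program.wp, Test.Holds, hv₂, State.setReg_reg, if_true,
          Nat.reduceEqDiff, if_false, e6, e20, e21, ind_false hvA]
        refine ⟨hW1, fun h => h.elim, fun _ => ⟨?_, ?_⟩⟩
        · exact hI.1.imp_right fun h => ⟨h.1, fun w hw hwv => h.2 w hw (hlt w hw hwv)⟩
        · exact hI.2.imp_right fun h => ⟨h.1, fun w hw hwv => h.2 w hw (hlt w hw hwv)⟩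
  · rintro s' ⟨⟨h1, h2⟩, hf⟩
    exact ⟨⟨h1.imp_right fun h => ⟨h.1, fun w hw => h.2 w hw w.2⟩,
      h2.imp_right fun h => ⟨h.1, fun w hw => h.2 w hw w.2⟩⟩, hf⟩

end RAM

/-! ### Rounds of forced choices and their termination. -/

namespace RAM

open SimpleGraph

variable {W : ℕ} {s : State} {n : ℕ} {G : SimpleGraph (Fin n)} {x y : Fin n}
  {adj : Fin n → List (Fin n)}

/-- The state holds the input, the partners, the remaining clauses and the remaining literals. -/
structure HoldsChoice (adj : Fin n → List (Fin n)) (x y : Fin n) (pt : Fin n → Option (Fin n))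
    (A L : Finset (Fin n)) (s : State) : Prop extends HoldsInput adj x y s where
  partner : ∀ v : Fin n, s.mem 5 v = enc (pt v)
  clauses : ∀ v : Fin n, s.mem 6 v = ind (v ∈ A)
  literals : ∀ v : Fin n, s.mem 7 v = ind (v ∈ L)
  reg_five : s.reg 5 = 0

/-- The partner of a literal. -/
def mate (pt : Fin n → Option (Fin n)) (d : Fin n) : Fin n := (pt d).getD d

/-- Make the choice in register `20`, if there is one. -/
def chooseForced : Program :=
  .ite (.ne 20 5)
    ((.const 4 1 ;; .sub 22 20 4 ;; .load 23 5 22 ;; .sub 23 23 4 ;; .const 4 0 ;;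
        .store 7 22 4 ;; .store 7 23 4) ;;
      adjLoop 22 7 8 9 (.const 4 0 ;; .store 6 9 4))
    .skip

theorem runs_chooseForced (hG : IsAdjacencyLists G adj) {pt : Fin n → Option (Fin n)}
    {A L : Finset (Fin n)} (hs : HoldsChoice adj x y pt A L s)
    (hW : n + ∑ u, (adj u).length + 5 < W) (hA : ∀ a ∈ A, G.Priv x y a) {q e : Fin n}
    (hq : pt q = some e) (h20 : s.reg 20 = q + 1) :
    Runs W chooseForced s (6 * (n + ∑ u, (adj u).length) + 13) fun s' =>
      HoldsChoice adj x y pt (clausesAfter (G.Hits x y) A q) (litsAfter (mate pt) L q) s' ∧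
        Frame chooseForced s s' := by
  have hlen : (adj q).length ≤ n := (hG.nodup q).length_le_card.trans (by simp)
  refine Runs.framed ((Runs.ite (T := 7 + ((2 + 4) * (adj q).length + 5)) (fun _ => ?_)
    fun h => ?_).mono (by omega) fun _ h => h)
  swap
  · simp [Test.Holds, h20, hs.reg_five] at h
  refine Runs.cut (R := fun t => t.reg 22 = q ∧ ∀ v : Fin n, t.mem 7 v
      = ind (v ∈ litsAfter (mate pt) L q)) (runs_of_wp (p := .const 4 1 ;; .sub 22 20 4 ;;
      .load 23 5 22 ;; .sub 23 23 4 ;; .const 4 0 ;; .store 7 22 4 ;; .store 7 23 4) ?_)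
    fun s₁ hf₁ h₁ => ?_
  · simp only [Program.wp, State.setReg_reg, State.setReg_mem, State.setMem_reg, State.setMem_mem,
      if_true, Nat.reduceEqDiff, if_false, h20, Nat.add_sub_cancel, hs.partner, hq, enc]
    refine ⟨by omega, by omega, trivial, fun v => ?_⟩
    simp only [Function.update_apply, Fin.val_inj, hs.literals]
    have hm : mate pt q = e := by simp [mate, hq]
    by_cases h1 : v = e
    · rw [if_pos h1, ind_false]
      rw [mem_litsAfter, hm]
      exact fun h => h.1 h1
    · rw [if_neg h1]
      by_cases h2 : v = q
      · rw [if_pos h2, ind_false]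
        rw [mem_litsAfter]
        exact fun h => h.2.1 h2
      · rw [if_neg h2]
        refine ind_congr ?_
        rw [mem_litsAfter, hm]
        exact ⟨fun h => ⟨h1, h2, h⟩, fun h => h.2.2⟩
  · have hs₁ := hs.toHoldsInput.frame hf₁ ⟨⟨rfl, rfl⟩, rfl, rfl, rfl⟩
    refine (runs_adjLoop q h₁.1 hs₁.toHoldsLists (by decide) ⟨rfl, rfl, rfl⟩ (by omega)
      (fun l t => ∀ v : Fin n, t.mem 6 v = ind (v ∈ A ∧ v ∉ l)) 2 ?_ ?_ ?_).mono le_rfl ?_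
    · exact fun l t r k hr hl => hl
    · intro v
      rw [hf₁.mem 6 rfl, hs.clauses]
      simp
    · intro l w l' hl t hft hw hI
      refine runs_of_wp (p := .const 4 0 ;; .store 6 9 4) ?_
      simp only [Program.wp, State.setReg_reg, State.setReg_mem, State.setMem_mem,
        if_true, Nat.reduceEqDiff, if_false, hw]
      refine ⟨by omega, fun v => ?_⟩
      simp only [Function.update_apply, Fin.val_inj, hI]
      by_cases h : v = w
      · rw [if_pos h, ind_false]
        simp [h]
      · rw [if_neg h]
        refine ind_congr ?_
        simp [h]
    · rintro s₂ ⟨hI, hf₂⟩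
      refine ⟨hs₁.frame hf₂ ⟨⟨rfl, rfl⟩, rfl, rfl, rfl⟩, ?_, ?_, ?_, ?_⟩
      · intro v
        rw [hf₂.mem 5 rfl, hf₁.mem 5 rfl, hs.partner]
      · intro v
        rw [hI]
        refine ind_congr ?_
        rw [clausesAfter, Finset.mem_filter, hG.mem_iff]
        exact ⟨fun h => ⟨h.1, fun h' => h.2 h'.2.symm⟩,
          fun h => ⟨h.1, fun h' => h.2 ⟨hA v h.1, h'.symm⟩⟩⟩
      · intro v
        rw [hf₂.mem 7 rfl, h₁.2]
      · rw [hf₂.reg 5 rfl, hf₁.reg 5 rfl, hs.reg_five]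

/-- One round: find a forced choice and make it. -/
def roundProgram : Program := .const 20 0 ;; degLoop ;; findLoop ;; chooseForced

theorem HoldsChoice.frame {p : Program} {s' : State} {pt : Fin n → Option (Fin n)}
    {A L : Finset (Fin n)} (h : HoldsChoice adj x y pt A L s) (hf : Frame p s s')
    (hp : (p.writesMem 0 = false ∧ p.writesMem 1 = false) ∧
      p.writesReg 0 = false ∧ p.writesReg 1 = false ∧ p.writesReg 2 = false)
    (hp' : p.writesMem 5 = false ∧ p.writesMem 6 = false ∧ p.writesMem 7 = false ∧
      p.writesReg 5 = false) :
    HoldsChoice adj x y pt A L s' :=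
  ⟨h.toHoldsInput.frame hf hp, by rw [hf.mem 5 hp'.1]; exact h.partner,
    by rw [hf.mem 6 hp'.2.1]; exact h.clauses, by rw [hf.mem 7 hp'.2.2.1]; exact h.literals,
    by rw [hf.reg 5 hp'.2.2.2]; exact h.reg_five⟩

theorem IsForced.mem {A L : Finset (Fin n)} {q : Fin n} (h : IsForced G x y A L q) : q ∈ L := by
  obtain ⟨a, -, ⟨-, h⟩ | ⟨-, -, h⟩⟩ := h
  exacts [(mem_lits.1 h).1, (mem_bigLits.1 h).1.1]

theorem IsForced.exists_hits {A L : Finset (Fin n)} {q : Fin n} (h : IsForced G x y A L q) :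
    ∃ a ∈ A, G.Hits x y a q := by
  obtain ⟨a, ha, ⟨-, h⟩ | ⟨-, -, h⟩⟩ := h
  exacts [⟨a, ha, (mem_lits.1 h).2⟩, ⟨a, ha, (mem_bigLits.1 h).1.2⟩]

theorem IsForced.choosable_iff {τ : Fin n → Fin n} {A L : Finset (Fin n)} {q : Fin n}
    (h : IsForced G x y A L q) (hC : ChoiceSystem (G.Hits x y) τ A L) :
    Choosable (G.Hits x y) τ (clausesAfter (G.Hits x y) A q) (litsAfter τ L q) ↔
      Choosable (G.Hits x y) τ A L := by
  obtain ⟨a, ha, ⟨h1, h⟩ | ⟨h2, h1, h⟩⟩ := h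
  exacts [choosable_after_iff_of_single hC ha h1 h, choosable_after_iff_of_big hC ha h2 h1 h]

/-- The failure flag describes the clauses and literals before the choice of this round is made. -/
theorem runs_roundProgram (hG : IsAdjacencyLists G adj) {pt : Fin n → Option (Fin n)}
    {A L : Finset (Fin n)} (hs : HoldsChoice adj x y pt A L s)
    (hW : n + ∑ u, (adj u).length + 5 < W) (hA : ∀ a ∈ A, G.Priv x y a)
    (hL : ∀ q ∈ L, ∃ e, pt q = some e) :
    Runs W roundProgram s (100 * (n + ∑ u, (adj u).length)) fun s' =>
      ((∃ q, s'.reg 20 ≠ 0 ∧ IsForced G x y A L q ∧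
          HoldsChoice adj x y pt (clausesAfter (G.Hits x y) A q) (litsAfter (mate pt) L q) s') ∨
        s'.reg 20 = 0 ∧ s'.reg 5 = 0 ∧ ∀ v ∈ A, ¬IsTight G x y A L v) ∧
      ((s'.reg 21 = 1 ∧ ∃ a ∈ A, (lits (G.Hits x y) L a).card = 0) ∨
        s'.reg 21 = s.reg 21 ∧ ∀ v ∈ A, (lits (G.Hits x y) L v).card ≠ 0) := by
  have hn : 0 < n := x.pos
  refine (Runs.cut (T := 1) (T' := (20 * (n + ∑ u, (adj u).length) + 2) +
    ((40 * (n + ∑ u, (adj u).length) + 2) + (6 * (n + ∑ u, (adj u).length) + 13)))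
    (R := fun t => t.reg 20 = 0) (runs_of_wp (p := .const 20 0) ?_) fun s₁ hf₁ h₁ => ?_).mono
    (by omega) fun _ h => h
  · simp only [Program.wp, State.setReg_reg, if_true, and_true]
    omega
  have hs₁ := hs.frame hf₁ ⟨⟨rfl, rfl⟩, rfl, rfl, rfl⟩ ⟨rfl, rfl, rfl, rfl⟩
  refine Runs.cut (runs_degLoop hG hs₁.toHoldsInput hW hs₁.clauses) fun s₂ hf₂ h₂ => ?_
  have hs₂ := hs₁.frame hf₂ ⟨⟨rfl, rfl⟩, rfl, rfl, rfl⟩ ⟨rfl, rfl, rfl, rfl⟩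
  refine Runs.cut (runs_findLoop hG hs₂.toHoldsInput hW hA hs₂.clauses hs₂.literals h₂.1
    ((hf₂.reg 20 rfl).trans h₁)) fun s₃ hf₃ h₃ => ?_
  have hs₃ := hs₂.frame hf₃ ⟨⟨rfl, rfl⟩, rfl, rfl, rfl⟩ ⟨rfl, rfl, rfl, rfl⟩
  obtain ⟨⟨hc, hfail⟩, -⟩ := h₃
  have e21 : s₂.reg 21 = s.reg 21 := (hf₂.reg 21 rfl).trans (hf₁.reg 21 rfl)
  rw [e21] at hfail
  rcases hc with ⟨q, h20, hq⟩ | ⟨h20, hno⟩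
  · obtain ⟨e, he⟩ := hL q hq.mem
    refine (runs_chooseForced hG hs₃ hW hA he h20).mono le_rfl fun s₄ h₄ => ?_
    rw [h₄.2.reg 21 rfl, h₄.2.reg 20 rfl]
    exact ⟨Or.inl ⟨q, by omega, hq, h₄.1⟩, hfail⟩
  · refine (Runs.ite (T := 1) (fun h => ?_) fun _ => runs_of_wp (p := .skip) ?_).mono
      (by omega) fun _ h => h
    · simp [Test.Holds, h20, hs₃.reg_five] at h
    · exact ⟨Or.inr ⟨h20, hs₃.reg_five, hno⟩, hfail⟩

/-- Make forced choices as long as there are any. -/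
def peelLoop : Program := .while (.ne 20 5) roundProgram

/-- Strong induction on the number of clauses: a forced literal occurs in a remaining clause, so
choosing it removes one. Continuing after a failure is harmless, since forced choices preserve
choosability in both directions. -/
theorem runs_peelLoop (hG : IsAdjacencyLists G adj) {pt : Fin n → Option (Fin n)}
    (hW : n + ∑ u, (adj u).length + 5 < W) {A L : Finset (Fin n)}
    (hs : HoldsChoice adj x y pt A L s) (hA : ∀ a ∈ A, G.Priv x y a)
    (hL : ∀ q ∈ L, ∃ e, pt q = some e) (hC : ChoiceSystem (G.Hits x y) (mate pt) A L)
    (h21 : s.reg 21 = 0 ∨ s.reg 21 = 1 ∧ ¬Choosable (G.Hits x y) (mate pt) A L)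
    (h20 : s.reg 20 ≠ 0) :
    Runs W peelLoop s ((A.card + 1) * (100 * (n + ∑ u, (adj u).length) + 1) + 1) fun s' =>
      (s'.reg 21 = 0 ∧ Choosable (G.Hits x y) (mate pt) A L) ∨
        (s'.reg 21 = 1 ∧ ¬Choosable (G.Hits x y) (mate pt) A L) := by
  induction hm : A.card using Nat.strong_induction_on generalizing A L s with
  | _ m ih =>
  subst hm
  refine (Runs.while_true (T' := A.card * (100 * (n + ∑ u, (adj u).length) + 1) + 1) ?_
    ((runs_roundProgram hG hs hW hA hL).mono le_rfl ?_)).mono (by ring_nf; omega) fun _ h => h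
  · simp [Test.Holds, hs.reg_five, h20]
  rintro s' ⟨⟨q, h20', hq, hs'⟩ | ⟨h20', h5, hno⟩, hfail⟩
  · have hiff := hq.choosable_iff hC
    have hlt : (clausesAfter (G.Hits x y) A q).card < A.card := by
      obtain ⟨a, ha, haq⟩ := hq.exists_hits
      refine Finset.card_lt_card (Finset.filter_ssubset.2 ⟨a, ha, not_not.2 haq⟩)
    have := ih _ hlt hs' (fun a ha => hA a (Finset.mem_filter.1 ha).1)
      (fun d hd => hL d (mem_litsAfter.1 hd).2.2) (hC.after hq.mem) ?_ h20' rfl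
    · simp only [hiff] at this
      refine this.mono (Nat.add_le_add_right (Nat.mul_le_mul_right _ hlt) 1) fun _ h => h
    · rw [hiff]
      rcases hfail with ⟨h, a, ha, h0⟩ | ⟨h, -⟩
      · exact Or.inr ⟨h, not_choosable ha h0⟩
      · rwa [h]
  · refine (Runs.while_false (by simp [Test.Holds, h20', h5]) ?_).mono (by omega) fun _ h => h
    rcases hfail with ⟨h, a, ha, h0⟩ | ⟨h, h0⟩
    · exact Or.inr ⟨h, not_choosable ha h0⟩
    · have hCh : Choosable (G.Hits x y) (mate pt) A L := by
        refine choosable_of_two_le hC (fun a ha => ?_) fun a ha h2 h1 => ?_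
        · have h1 := h0 a ha
          have h2 := hno a ha
          unfold IsTight at h2
          omega
        · exact hno a ha (Or.inr ⟨h2, h1⟩)
      refine Or.inl ⟨?_, hCh⟩
      rw [h]
      exact h21.resolve_right fun h' => h'.2 hCh

end RAM

/-! ## The decision procedure -/

namespace RAM

open SimpleGraph

variable {n : ℕ} {G : SimpleGraph (Fin n)} {x y : Fin n} {adj : Fin n → List (Fin n)}

open Classical in
/-- The clauses of the choice problem of an edge. -/
noncomputable def needySet (G : SimpleGraph (Fin n)) (x y : Fin n) (pt : Fin n → Option (Fin n)) :
    Finset (Fin n) := Finset.univ.filter (G.Needy x y pt)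

open Classical in
/-- The literals of the choice problem of an edge. -/
noncomputable def mutualSet (G : SimpleGraph (Fin n)) (x y : Fin n) (pt : Fin n → Option (Fin n)) :
    Finset (Fin n) := Finset.univ.filter (G.Mutual x y pt)

variable {pt : Fin n → Option (Fin n)}

theorem mem_needySet {v : Fin n} : v ∈ needySet G x y pt ↔ G.Needy x y pt v := by
  simp [needySet]

theorem mem_mutualSet {v : Fin n} : v ∈ mutualSet G x y pt ↔ G.Mutual x y pt v := by
  simp [mutualSet]

theorem mate_eq {d e : Fin n} (h : pt d = some e) : mate pt d = e := by
  simp [mate, h]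

/-- The field `disj` is where neediness enters; `common` comes from the hexagon and `partner` from
hexagon and heptagon together, with mates as the adjacent candidates. -/
theorem choiceSystem (h6 : (cycleGraph 6).Free G) (h7 : (cycleGraph 7).Free G) (hxy : G.Adj x y)
    (hpt : G.IsPartner x y pt) :
    ChoiceSystem (G.Hits x y) (mate pt) (needySet G x y pt) (mutualSet G x y pt) := by
  have key : ∀ {d}, d ∈ mutualSet G x y pt → G.Cand x y d ∧ pt d = some (mate pt d) ∧
      pt (mate pt d) = some d ∧ G.Adj d (mate pt d) ∧ G.Cand x y (mate pt d) := by
    intro d hd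
    obtain ⟨hC, e, hde, hed⟩ := mem_mutualSet.1 hd
    rw [mate_eq hde]
    exact ⟨hC, hde, hed, hpt.some _ _ hde⟩
  constructor
  · intro d hd
    obtain ⟨h1, h2, h3, h4, h5⟩ := key hd
    exact mem_mutualSet.2 ⟨h5, d, h3, h2⟩
  · intro d hd
    exact mate_eq (key hd).2.2.1
  · exact fun hd => (key hd).1.exists_hits
  · intro a d ha hd had had'
    obtain ⟨e, he, hae⟩ := (mem_needySet.1 ha).2 d (key hd).1 had.2
    rw [mate_eq he] at had'
    exact hae had'.2
  · intro a b c d e hd he hde hb ha ha' hc hba hca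
    have kd := key hd
    have ke := key he
    exact eq_of_common_hit h6 hxy kd.1 kd.2.2.2.2 kd.2.2.2.1 ke.1 ke.2.2.2.2 ke.2.2.2.1 hde hb ha
      ha' hc hba hca
  · intro a b c d e hd he hde hde' ha hb ha' hc hca
    have kd := key hd
    have ke := key he
    exact eq_or_eq_of_partner_hit h6 h7 hxy kd.1 kd.2.2.2.2 kd.2.2.2.1 ke.1 ke.2.2.2.2 ke.2.2.2.1
      hde hde' ha hb ha' hc hca

theorem isRelatingEdge_iff_choosable (h6 : (cycleGraph 6).Free G) (h7 : (cycleGraph 7).Free G)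
    (hxy : G.Adj x y) (hpt : G.IsPartner x y pt) :
    IsRelatingEdge G x y ↔
      Choosable (G.Hits x y) (mate pt) (needySet G x y pt) (mutualSet G x y pt) := by
  classical
  rw [isRelatingEdge_iff_exists_mutual h6 h7 hxy hpt]
  constructor
  · rintro ⟨T, hT, hT', hTd⟩
    refine ⟨Finset.univ.filter (· ∈ T), fun d hd => ?_, fun d hd hd' => ?_, fun a ha => ?_⟩
    · exact mem_mutualSet.2 (hT d (Finset.mem_filter.1 hd).2)
    · have hdT := (Finset.mem_filter.1 hd).2
      obtain ⟨-, e, hde, -⟩ := hT d hdT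
      rw [mate_eq hde] at hd'
      exact hT' d hdT e (Finset.mem_filter.1 hd').2 hde
    · obtain ⟨d, hd, had⟩ := hTd a (mem_needySet.1 ha)
      exact ⟨d, by simpa using hd, (mem_needySet.1 ha).1, had⟩
  · rintro ⟨T, hTL, hT, hTA⟩
    refine ⟨T, fun d hd => mem_mutualSet.1 (hTL hd), fun d hd e he hde => ?_, fun a ha => ?_⟩
    · exact hT d hd ((mate_eq hde).symm ▸ he)
    · obtain ⟨d, hd, had⟩ := hTA a (mem_needySet.2 ha)
      exact ⟨d, hd, had.2⟩

/-- The program that decides whether an edge is relating. -/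
def relatingProgram : Program :=
  nearLoop 1 ;; nearLoop 2 ;; candLoop ;; partnerLoop ;; needyLoop ;; mutualLoop ;;
    (.const 5 0 ;; .const 20 1 ;; .const 21 0) ;; peelLoop ;; (.const 4 1 ;; .sub 0 4 21)

theorem holdsInput_edgeInput (adj : Fin n → List (Fin n)) (x y : Fin n) :
    HoldsInput adj x y (edgeInput adj x y) where
  offset := fun i hi => by simp [edgeInput, hi]
  concat := fun i => by simp [edgeInput]
  reg_zero := by simp [edgeInput]
  reg_one := by simp [edgeInput]
  reg_two := by simp [edgeInput]

theorem runs_relatingProgram (h6 : (cycleGraph 6).Free G) (h7 : (cycleGraph 7).Free G)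
    (hxy : G.Adj x y) (hG : IsAdjacencyLists G adj) {W : ℕ}
    (hW : n + ∑ u, (adj u).length + 5 < W) :
    Runs W relatingProgram (edgeInput adj x y) (500 * (n * (n + ∑ u, (adj u).length))) fun s =>
      (s.reg 0 = 1 ∧ IsRelatingEdge G x y) ∨ (s.reg 0 = 0 ∧ ¬IsRelatingEdge G x y) := by
  set X := n + ∑ u, (adj u).length with hX
  have hn : 2 ≤ n := by
    have h1 : x.val ≠ y.val := fun h => hxy.ne (Fin.ext h)
    have := x.2
    have := y.2
    omega
  have hpt := isPartner_lastWith (x := x) (y := y) hG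
  set pt := fun d => lastWith (G.Cand x y) (adj d) with hptd
  have hcard : (needySet G x y pt).card ≤ n := (Finset.card_le_univ _).trans (by simp)
  have hs₀ := holdsInput_edgeInput adj x y
  -- Only the needy test and the forcing rounds cost multiples of `n * X`; the linear terms are
  -- absorbed through `2 * X ≤ n * X`.
  have htime : (20 * X + 2) + ((20 * X + 2) + ((30 * X + 2) + ((20 * X + 2) +
      (((30 * n + 33) * X + 2) + ((30 * X + 2) + (3 + ((((needySet G x y pt).card + 1) *
      (100 * X + 1) + 1) + 2))))))) ≤ 500 * (n * X) := by
    have h1 : ((needySet G x y pt).card + 1) * (100 * X + 1) ≤ (n + 1) * (100 * X + 1) :=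
      Nat.mul_le_mul_right _ (by omega)
    have h2 : 2 * X ≤ n * X := Nat.mul_le_mul_right _ hn
    have h3 : n ≤ X := by omega
    have h4 : (n + 1) * (100 * X + 1) = 100 * (n * X) + 100 * X + n + 1 := by ring
    have h5 : (30 * n + 33) * X = 30 * (n * X) + 33 * X := by ring
    omega
  refine Runs.mono (Runs.cut (runs_nearLoop hG hs₀ hW (Or.inl rfl) hs₀.reg_one)
    fun s₁ hf₁ h₁ => ?_) htime fun _ h => h
  have hs₁ := hs₀.frame hf₁ ⟨⟨rfl, rfl⟩, rfl, rfl, rfl⟩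
  refine Runs.cut (runs_nearLoop hG hs₁ hW (Or.inr rfl) hs₁.reg_two) fun s₂ hf₂ h₂ => ?_
  have hs₂ := hs₁.frame hf₂ ⟨⟨rfl, rfl⟩, rfl, rfl, rfl⟩
  have a2 : ∀ v : Fin n, s₂.mem 2 v = ind (G.Near x v) := by rw [hf₂.mem 2 rfl]; exact h₁.1
  refine Runs.cut (runs_candLoop hG hs₂ hW a2 h₂.1) fun s₃ hf₃ h₃ => ?_
  have hs₃ := hs₂.frame hf₃ ⟨⟨rfl, rfl⟩, rfl, rfl, rfl⟩
  refine Runs.cut (runs_partnerLoop hs₃ hW h₃.1) fun s₄ hf₄ h₄ => ?_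
  have hs₄ := hs₃.frame hf₄ ⟨⟨rfl, rfl⟩, rfl, rfl, rfl⟩
  refine Runs.cut (runs_needyLoop hG hs₄ hW (pt := pt) (by
      rw [hf₄.mem 2 rfl, hf₃.mem 2 rfl]; exact a2) (by
      rw [hf₄.mem 3 rfl, hf₃.mem 3 rfl]; exact h₂.1) (by rw [hf₄.mem 4 rfl]; exact h₃.1) h₄.1)
    fun s₅ hf₅ h₅ => ?_
  have hs₅ := hs₄.frame hf₅ ⟨⟨rfl, rfl⟩, rfl, rfl, rfl⟩
  have a5 : ∀ v : Fin n, s₅.mem 5 v = enc (pt v) := by rw [hf₅.mem 5 rfl]; exact h₄.1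
  refine Runs.cut (runs_mutualLoop hs₅ hW (pt := pt) (by
      rw [hf₅.mem 4 rfl, hf₄.mem 4 rfl]; exact h₃.1) a5) fun s₆ hf₆ h₆ => ?_
  have hs₆ := hs₅.frame hf₆ ⟨⟨rfl, rfl⟩, rfl, rfl, rfl⟩
  -- Register `5` is the constant zero of the loop test; register `20` starts nonzero so that the
  -- first round takes place.
  refine Runs.cut (R := fun t => t.reg 5 = 0 ∧ t.reg 20 = 1 ∧ t.reg 21 = 0)
    (runs_of_wp (p := .const 5 0 ;; .const 20 1 ;; .const 21 0) ?_) fun s₇ hf₇ h₇ => ?_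
  · simp [Program.wp]
    omega
  have hs₇ : HoldsChoice adj x y pt (needySet G x y pt) (mutualSet G x y pt) s₇ := by
    refine ⟨hs₆.frame hf₇ ⟨⟨rfl, rfl⟩, rfl, rfl, rfl⟩, ?_, ?_, ?_, h₇.1⟩
    · rw [hf₇.mem 5 rfl, hf₆.mem 5 rfl]
      exact a5
    · intro v
      rw [hf₇.mem 6 rfl, hf₆.mem 6 rfl, h₅.1]
      exact ind_congr mem_needySet.symm
    · intro v
      rw [hf₇.mem 7 rfl, h₆.1]
      exact ind_congr mem_mutualSet.symm
  refine Runs.cut (runs_peelLoop hG hW hs₇ (fun a ha => (mem_needySet.1 ha).1)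
    (fun q hq => ?_) (choiceSystem h6 h7 hxy hpt) (Or.inl h₇.2.2) (by rw [h₇.2.1]; exact one_ne_zero))
    fun s₈ hf₈ h₈ => ?_
  · obtain ⟨-, e, he, -⟩ := mem_mutualSet.1 hq
    exact ⟨e, he⟩
  · rw [← isRelatingEdge_iff_choosable h6 h7 hxy hpt] at h₈
    refine runs_of_wp (p := .const 4 1 ;; .sub 0 4 21) ?_
    simp only [Program.wp, State.setReg_reg, if_true, Nat.reduceEqDiff, if_false]
    refine ⟨by omega, ?_⟩
    rcases h₈ with ⟨h, hR⟩ | ⟨h, hR⟩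
    · exact Or.inl ⟨by rw [h], hR⟩
    · exact Or.inr ⟨by rw [h], hR⟩

end RAM

/-! ### From list lengths to the number of edges, and the final constants. -/

theorem IsAdjacencyLists.sum_length {n : ℕ} {G : SimpleGraph (Fin n)} {adj : Fin n → List (Fin n)}
    (hG : IsAdjacencyLists G adj) : ∑ u, (adj u).length = 2 * G.edgeSet.ncard := by
  classical
  rw [Set.ncard_eq_toFinset_card', ← SimpleGraph.edgeFinset, ← G.sum_degrees_eq_twice_card_edges]
  refine Finset.sum_congr rfl fun u _ => ?_
  rw [← List.toFinset_card_of_nodup (hG.nodup u), ← G.card_neighborFinset_eq_degree]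
  congr 1
  ext v
  simp [hG.mem_iff]

/-- There is one program that decides, for every graph `G` without cycles of length `6` and `7` and
every edge `xy` of `G`, given by any adjacency list representation, whether `xy` is relating, in
`O(|V| (|V| + |E|))` steps on words of `O(log |V|)` bits. The answer (`1` for yes, `0` for no) is
left in register `0`. -/
theorem mainTheorem2 :
    ∃ (P : RAM.Program) (k C : ℕ), ∀ (n : ℕ) (G : SimpleGraph (Fin n)) (x y : Fin n)
      (adj : Fin n → List (Fin n)),
      (SimpleGraph.cycleGraph 6).Free G → (SimpleGraph.cycleGraph 7).Free G → G.Adj x y →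
      IsAdjacencyLists G adj →
      ∃ (t : ℕ) (s : RAM.State), RAM.Exec (n ^ k) P (edgeInput adj x y) t s ∧
        t ≤ C * (n * (n + G.edgeSet.ncard)) ∧
        (IsRelatingEdge G x y → s.reg 0 = 1) ∧ (¬ IsRelatingEdge G x y → s.reg 0 = 0) := by
  -- The lists have total length $2|E|$, so `500` doubles to `1000`. Exponent `5` suffices because
  -- $n + n^2 + 5 < n^5$ for $n \ge 2$, and an edge provides two vertices.
  refine ⟨RAM.relatingProgram, 5, 1000, fun n G x y adj h6 h7 hxy hG => ?_⟩
  have hn : 2 ≤ n := by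
    have h1 : x.val ≠ y.val := fun h => hxy.ne (Fin.ext h)
    have := x.2
    have := y.2
    omega
  have hM : ∑ u, (adj u).length ≤ n * n := by
    refine (Finset.sum_le_card_nsmul _ _ n fun u _ => ?_).trans (by simp)
    exact (hG.nodup u).length_le_card.trans (by simp)
  have hW : n + ∑ u, (adj u).length + 5 < n ^ 5 := by
    have h1 : 2 * n ≤ n * n := Nat.mul_le_mul_right _ hn
    have h2 : 2 ^ 3 * (n * n) ≤ n ^ 3 * (n * n) := Nat.mul_le_mul_right _ (Nat.pow_le_pow_left hn 3)
    have h3 : n ^ 3 * (n * n) = n ^ 5 := by ring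
    omega
  obtain ⟨t, s, hE, ht, hs⟩ := RAM.runs_relatingProgram h6 h7 hxy hG hW
  refine ⟨t, s, hE, ht.trans ?_, ?_, ?_⟩
  · rw [hG.sum_length, mul_left_comm, mul_left_comm 1000]
    exact Nat.mul_le_mul_left n (by omega)
  · exact fun h => hs.elim And.left fun h' => absurd h h'.2
  · exact fun h => hs.elim (fun h' => absurd h'.2 h) And.left
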